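/- Let $X_1,\dots,X_n$ be independent random variables with values in $\mathbb R^{d_1},\dots,\mathbb R^{d_n}$, with distribution functions $F_{X_i}$, characteristic functions $f_{X_i}(t)=\mathbb E\,e^{\mathrm i X_i\cdot t}$ and joint law $\mu=\bigotimes_i \mathrm{Law}(X_i)$. Let $\rho_i$ be symmetric $\sigma$-finite Borel measures on $\mathbb R^{d_i}$ with $\int 1\wedge|t|^2\,\rho_i(dt)<\infty$, put $\rho_S=\bigotimes_{i\in S}\rho_i$ for $S\subset\{1,\dots,n\}$, and $\psi_i(x)=\int \bigl(1-\cos(x\cdot t)\bigr)\,\rho_i(dt)$. Let $\mathcal W(\mathbf F_{\mathbf X}(x))$, $x\in\mathbb R^{d_1}\times\dots\times\mathbb R^{d_n}$, be the Brownian sheet evaluated at $\mathbf F_{\mathbf X}(x)=(F_{X_1}(x_1),\dots,F_{X_n}(x_n))$; for $d_i>1$ this is understood as the centered Gaussian field with covariance $\prod_{i=1}^n F_{X_i}(x_i\wedge y_i)$, where $\wedge$ is the componentwise minimum (if all $d_i=1$, composing a Brownian sheet on $[0,1]^n$ with $\mathbf F_{\mathbf X}$ gives such a field). For $f\in L^2(\mu)$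 let $\int f\,d\mathcal W(\mathbf F_{\mathbf X}(x))$ be the Wiener integral, i.e. the $L^2$-continuous linear extension of $\mathbf 1_{(-\infty,x]}\mapsto\mathcal W(\mathbf F_{\mathbf X}(x))$, and put $\mathcal W(\mathbf F_{\mathbf X})(A)=\int \mathbf 1_A\,d\mathcal W(\mathbf F_{\mathbf X}(x))$ for measurable $A$. For $K\in L^2(\mu\otimes\mu)$ let $\iint K(x,y)\,d\mathcal W(\mathbf F_{\mathbf X}(x))\,d\mathcal W(\mathbf F_{\mathbf X}(y))$ be the double integral with the diagonal included, i.e. the limit in probability (if it exists), along the finite measurable partitions $\pi$ directed by refinement, of $$\sum_{A,A'\in\pi}\Bigl(\frac{1}{\mu(A)\mu(A')}\int_{A}\int_{A'}K\,d\mu\,d\mu\Bigr)\,\mathcal W(\mathbf F_{\mathbf X})(A)\,\mathcal W(\mathbf F_{\mathbf X})(A'),$$ where terms with $\mu(A)\mu(A')=0$ are $0$. For $S\subset\{1,\dots,n\}$ with $|S|\ge2$ let $$\mathbb G_S(t)=\int\prod_{i\in S}\bigl(e^{\mathrm i x_i\cdot t_i}-f_{X_i}(t_i)\bigr)\,d\mathcal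 W(\mathbf F_{\mathbf X}(x)),\qquad t=(t_i)_{i\in S},$$ in a version that is jointly measurable in $(t,\omega)$. If $\mathbb E\,\psi_i(X_i)<\infty$ for $1\le i\le n$, then almost surely $\|\mathbb G_S\|_{\rho_S}^2=\int|\mathbb G_S(t)|^2\,\rho_S(dt)$ is finite, the following double integral exists, and $$\|\mathbb G_S\|_{\rho_S}^2=\iint\prod_{i\in S}\Psi_i(x_i,y_i)\,d\mathcal W(\mathbf F_{\mathbf X}(x))\,d\mathcal W(\mathbf F_{\mathbf X}(y))\qquad\text{a.s.},$$ where, with an independent copy $X_i'$ of $X_i$, $$\Psi_i(x,y)=-\psi_i(x-y)+\mathbb E\,\psi_i(X_i-y)+\mathbb E\,\psi_i(x-X_i')-\mathbb E\,\psi_i(X_i-X_i').$$ -/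

import Mathlib

open MeasureTheory ProbabilityTheory
open scoped ENNReal

noncomputable section

/-- Points `x = (x_1, …, x_n)` of `ℝ^{d_1} × ⋯ × ℝ^{d_n}`. -/
abbrev MPoint {n : ℕ} (d : Fin n → ℕ) : Type := (i : Fin n) → EuclideanSpace ℝ (Fin (d i))

/-- The lower orthant `(-∞, x]` of `ℝ^m`. -/
def lowerOrthant {m : ℕ} (x : EuclideanSpace ℝ (Fin m)) : Set (EuclideanSpace ℝ (Fin m)) :=
  {z | ∀ j, z j ≤ x j}

/-- The lower orthant `(-∞, x]` of `ℝ^{d_1} × ⋯ × ℝ^{d_n}`. -/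
def lowerBox {n : ℕ} {d : Fin n → ℕ} (x : MPoint d) : Set (MPoint d) :=
  {z | ∀ i, z i ∈ lowerOrthant (x i)}

/-- The (multivariate) distribution function of a probability measure `ν` on `ℝ^m`. -/
def distFun {m : ℕ} (ν : Measure (EuclideanSpace ℝ (Fin m))) (x : EuclideanSpace ℝ (Fin m)) : ℝ :=
  ν.real (lowerOrthant x)

/-- The componentwise minimum `x ∧ y` of two vectors. -/
def vecMin {m : ℕ} (x y : EuclideanSpace ℝ (Fin m)) : EuclideanSpace ℝ (Fin m) :=
  WithLp.toLp 2 (fun j => min (x j) (y j))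

/-- `W` is (in law) a Brownian sheet indexed by `[0,1]^n`. -/
structure IsBrownianSheet {Ω : Type*} [MeasurableSpace Ω] (P : Measure Ω) {n : ℕ}
    (W : (Fin n → unitInterval) → Ω → ℝ) : Prop where
  gaussian : IsGaussianProcess W P
  centered : ∀ s, ∫ ω, W s ω ∂P = 0
  covariance : ∀ s t, ∫ ω, W s ω * W t ω ∂P = ∏ i, ((min (s i) (t i) : unitInterval) : ℝ)

/-- `B = W(F_1(·), …, F_n(·))` is the Brownian sheet in the clock given by the distribution
functions `F_i` of the probability measures `ν i`: the centered Gaussian field on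
`ℝ^{d_1} × ⋯ × ℝ^{d_n}` with covariance `∏ i, F_i(x_i ∧ y_i)`. If all `d i = 1`, then every
time-changed Brownian sheet is of this kind, see `IsBrownianSheet.timeChange`. -/
structure IsClockedBrownianSheet {Ω : Type*} [MeasurableSpace Ω] (P : Measure Ω) {n : ℕ}
    {d : Fin n → ℕ} (ν : (i : Fin n) → Measure (EuclideanSpace ℝ (Fin (d i))))
    (B : MPoint d → Ω → ℝ) : Prop where
  gaussian : IsGaussianProcess B P
  centered : ∀ x, ∫ ω, B x ω ∂P = 0
  covariance : ∀ x y, ∫ ω, B x ω * B y ω ∂P = ∏ i, distFun (ν i) (vecMin (x i) (y i))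

/-- The distribution function with values in `[0,1]`. -/
def distFunI {m : ℕ} (ν : Measure (EuclideanSpace ℝ (Fin m))) [IsProbabilityMeasure ν]
    (x : EuclideanSpace ℝ (Fin m)) : unitInterval :=
  ⟨distFun ν x, measureReal_nonneg, measureReal_le_one⟩

theorem IsBrownianSheet.timeChange {Ω : Type*} [MeasurableSpace Ω] {P : Measure Ω} {n : ℕ}
    {W : (Fin n → unitInterval) → Ω → ℝ} (hW : IsBrownianSheet P W)
    {d : Fin n → ℕ} (hd : ∀ i, d i = 1)
    (ν : (i : Fin n) → Measure (EuclideanSpace ℝ (Fin (d i)))) [∀ i, IsProbabilityMeasure (ν i)] :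
    IsClockedBrownianSheet P ν (fun x => W (fun i => distFunI (ν i) (x i))) where
  gaussian := hW.gaussian.comp_right _
  centered _ := hW.centered _
  covariance x y := by
    rw [hW.covariance]
    refine Finset.prod_congr rfl fun i _ => ?_
    have hmono : ∀ u v : EuclideanSpace ℝ (Fin (d i)), (∀ j, u j ≤ v j) →
        distFun (ν i) u ≤ distFun (ν i) v := fun u v h =>
      measureReal_mono (fun z hz j => (hz j).trans (h j))
    have hs : Subsingleton (Fin (d i)) := by rw [hd i]; infer_instance
    have hcases : (∀ j, x i j ≤ y i j) ∨ (∀ j, y i j ≤ x i j) := by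
      have j0 : Fin (d i) := ⟨0, by rw [hd i]; exact Nat.one_pos⟩
      rcases le_total (x i j0) (y i j0) with h | h
      · exact Or.inl fun j => by rw [Subsingleton.elim j j0]; exact h
      · exact Or.inr fun j => by rw [Subsingleton.elim j j0]; exact h
    rcases hcases with h | h
    · have e : vecMin (x i) (y i) = x i := by ext j; simp [vecMin, h j]
      have h' : distFunI (ν i) (x i) ≤ distFunI (ν i) (y i) := hmono _ _ h
      rw [e, min_eq_left h']; rfl
    · have e : vecMin (x i) (y i) = y i := by ext j; simp [vecMin, h j]
      have h' : distFunI (ν i) (y i) ≤ distFunI (ν i) (x i) := hmono _ _ h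
      rw [e, min_eq_right h']; rfl

/-- `I` is (a version of) the Wiener integral `∫ f dB` for `f ∈ L²(μ)`. The integral is the
`L²`-continuous linear extension of `1_{(-∞, x]} ↦ B x`, so this says that `(f, I)` lies in the
closure of the pairs `(∑ c_x 1_{(-∞, x]}, ∑ c_x B x)` in `L²(μ) × L²(P)`. -/
def IsWienerIntegral {𝕜 : Type*} [RCLike 𝕜] {Ω : Type*} [MeasurableSpace Ω] (P : Measure Ω)
    {n : ℕ} {d : Fin n → ℕ} (μ : Measure (MPoint d)) (B : MPoint d → Ω → ℝ)
    (f : MPoint d → 𝕜) (I : Ω → 𝕜) : Prop :=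
  MemLp f 2 μ ∧ MemLp I 2 P ∧
    ∀ ε : ℝ≥0∞, 0 < ε → ∃ c : MPoint d →₀ 𝕜,
      eLpNorm (fun z => f z - c.sum fun x a => a * (lowerBox x).indicator 1 z) 2 μ < ε ∧
      eLpNorm (fun ω => I ω - c.sum fun x a => a * (B x ω : 𝕜)) 2 P < ε

open Classical in
/-- A version of the Wiener integral `∫ f dB` of a real function (and `0` if there is none). -/
def wienerIntegral {Ω : Type*} [MeasurableSpace Ω] (P : Measure Ω)
    {n : ℕ} {d : Fin n → ℕ} (μ : Measure (MPoint d)) (B : MPoint d → Ω → ℝ)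
    (f : MPoint d → ℝ) : Ω → ℝ :=
  if h : ∃ I : Ω → ℝ, IsWienerIntegral P μ B f I then h.choose else 0

/-- The double Riemann sum `∑ a b, K_{ab} B(A_a) B(A_b)` over the finite partition into the cells
`A_a = π ⁻¹' {a}`. Here `K_{ab}` is the `μ ⊗ μ`-average of `K` over `A_a × A_b` (and `0` if this
is a null set), and `B(A) = ∫ 1_A dB`. The diagonal terms `a = b` are included. -/
def doubleSum {Ω : Type*} [MeasurableSpace Ω] (P : Measure Ω)
    {n : ℕ} {d : Fin n → ℕ} (μ : Measure (MPoint d)) (B : MPoint d → Ω → ℝ)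
    (K : MPoint d → MPoint d → ℝ) {k : ℕ} (π : MPoint d → Fin k) (ω : Ω) : ℝ :=
  ∑ a, ∑ b, (⨍ z in (π ⁻¹' {a}) ×ˢ (π ⁻¹' {b}), K z.1 z.2 ∂(μ.prod μ)) *
    wienerIntegral P μ B ((π ⁻¹' {a}).indicator 1) ω *
    wienerIntegral P μ B ((π ⁻¹' {b}).indicator 1) ω

/-- `Q` is (a version of) the double integral `∬ K(x, y) dB(x) dB(y)` with respect to the product
of the random measure `dB` with itself, diagonal included: the limit in probability of the double
Riemann sums along the finite measurable partitions, directed by refinement. A partition is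
given by a measurable labelling `π` of its cells; `π` refines `π₀` iff `π₀` is a function
of `π`. For `K(x, y) = f(x) g(y)` this is the product `∫ f dB · ∫ g dB`. -/
def IsDoubleIntegral {Ω : Type*} [MeasurableSpace Ω] (P : Measure Ω)
    {n : ℕ} {d : Fin n → ℕ} (μ : Measure (MPoint d)) (B : MPoint d → Ω → ℝ)
    (K : MPoint d → MPoint d → ℝ) (Q : Ω → ℝ) : Prop :=
  MemLp (fun z : MPoint d × MPoint d => K z.1 z.2) 2 (μ.prod μ) ∧ AEStronglyMeasurable Q P ∧
    ∀ ε : ℝ, 0 < ε → ∀ δ : ℝ≥0∞, 0 < δ →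
      ∃ (k₀ : ℕ) (π₀ : MPoint d → Fin k₀), Measurable π₀ ∧
        ∀ (k : ℕ) (π : MPoint d → Fin k), Measurable π → (∃ r : Fin k → Fin k₀, π₀ = r ∘ π) →
          P {ω | ε ≤ |doubleSum P μ B K π ω - Q ω|} ≤ δ

/-- The negative definite function `ψ(x) = ∫ (1 - cos (x · t)) ρ(dt)`. -/
def psiFun {m : ℕ} (ρ : Measure (EuclideanSpace ℝ (Fin m))) (x : EuclideanSpace ℝ (Fin m)) : ℝ :=
  ∫ t, (1 - Real.cos (inner ℝ x t)) ∂ρ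

/-- The doubly centered kernel
`Ψ(x, y) = -ψ(x - y) + E ψ(X - y) + E ψ(x - X') - E ψ(X - X')`, where `X, X'` are independent
with law `ν`. -/
def centeredPsi {m : ℕ} (ρ ν : Measure (EuclideanSpace ℝ (Fin m)))
    (x y : EuclideanSpace ℝ (Fin m)) : ℝ :=
  -psiFun ρ (x - y) + ∫ u, psiFun ρ (u - y) ∂ν + ∫ v, psiFun ρ (x - v) ∂ν
    - ∫ w : EuclideanSpace ℝ (Fin m) × EuclideanSpace ℝ (Fin m), psiFun ρ (w.1 - w.2) ∂(ν.prod ν)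

/-- `G` is (a jointly measurable version of) the random field
`G_S(t) = ∫ ∏_{i ∈ S} (exp (i x_i · t_i) - f_i(t_i)) dB(x)`, where `f_i` is the characteristic
function of `ν i`. -/
structure IsLimitField {Ω : Type*} [MeasurableSpace Ω] (P : Measure Ω) {n : ℕ} {d : Fin n → ℕ}
    (ν : (i : Fin n) → Measure (EuclideanSpace ℝ (Fin (d i)))) (μ : Measure (MPoint d))
    (B : MPoint d → Ω → ℝ) (S : Finset (Fin n))
    (G : ((i : S) → EuclideanSpace ℝ (Fin (d i))) → Ω → ℂ) : Prop where
  measurable : Measurable (Function.uncurry G)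
  integral : ∀ t, IsWienerIntegral P μ B
    (fun x => ∏ i : S, (Complex.exp (((inner ℝ (x i) (t i) : ℝ) : ℂ) * Complex.I)
      - charFun (ν i) (t i))) (G t)

end

/-! Put `e x t = ∏ i ∈ S, (exp (i x_i · t_i) - f_i(t_i))` and regard `x ↦ e x` as a field with
values in the Hilbert space `L²(ρ_S)`. Expanding `∫ e x t * conj (e y t) ρ_S(dt)` factor by factor
shows that `∏ Ψ_i` is the Gram kernel `⟨e x, e y⟩` (`ofReal_prod_centeredPsi`). The moment condition
`E ψ_i(X_i) < ∞` together with independence puts `e` in `L²(μ; L²(ρ_S))`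
(`isSquareField_prod_centeredChar`).

For a finite partition `π`, replace `e · t` by its cell means. The Wiener integral of this
projection is `h t = ∑ a, mean_a(t) W(A_a)`. Its squared norm in `L²(ρ_S)` is, path by path, exactly
the double Riemann sum of the Gram kernel, diagonal included (`integral_norm_sq_cellField`).

It remains to compare `h` with `G`. By the Itô contraction, `E ‖G - h‖²` is at most the `L²(μ ⊗
ρ_S)` error of the projection. That error is small for every `π` refining a suitable `π₀`:
approximate `e` by a Hilbert-valued simple function, take its level sets as `π₀`, and use that cell
means are best approximations (`IsSquareField.exists_partition`). Hence `‖h‖² → ‖G‖²` in `L¹`, and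
Markov's inequality gives convergence in probability (`isDoubleIntegral_norm_sq`). Only second
moments of the noise enter. -/

noncomputable section

/-! ### Square norms and Gram matrices -/

section SquareNorm

variable {α : Type*} [MeasurableSpace α] {E : Type*} [NormedAddCommGroup E]

theorem eLpNorm_two_sq (f : α → E) (μ : Measure α) :
    eLpNorm f 2 μ ^ 2 = ∫⁻ x, ‖f x‖ₑ ^ 2 ∂μ := by
  have h := eLpNorm_nnreal_pow_eq_lintegral (μ := μ) (f := f) (p := 2) (by norm_num)
  simpa using h

theorem eLpNorm_two_le_of_sq_le {β : Type*} [MeasurableSpace β] {F : Type*}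
    [NormedAddCommGroup F] {f : α → E} {μ : Measure α} {g : β → F} {ν : Measure β}
    (h : ∫⁻ x, ‖f x‖ₑ ^ 2 ∂μ ≤ ∫⁻ x, ‖g x‖ₑ ^ 2 ∂ν) : eLpNorm f 2 μ ≤ eLpNorm g 2 ν := by
  rw [← eLpNorm_two_sq, ← eLpNorm_two_sq] at h
  exact (ENNReal.pow_le_pow_left_iff two_ne_zero).mp h

theorem lintegral_enorm_sq_eq {f : α → E} {μ : Measure α} (hf : MemLp f 2 μ) :
    ∫⁻ x, ‖f x‖ₑ ^ 2 ∂μ = ENNReal.ofReal (∫ x, ‖f x‖ ^ 2 ∂μ) := by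
  rw [ofReal_integral_eq_lintegral_ofReal
    ((memLp_two_iff_integrable_sq_norm hf.1).1 hf) (ae_of_all _ fun x => by positivity)]
  refine lintegral_congr fun x => ?_
  rw [ENNReal.ofReal_pow (norm_nonneg _), ofReal_norm]

end SquareNorm

section Gram

variable {𝕜 : Type*} [RCLike 𝕜]

theorem norm_sq_sum_mul_ofReal {ι : Type*} (s : Finset ι) (c : ι → 𝕜) (r : ι → ℝ) :
    ‖∑ i ∈ s, c i * (r i : 𝕜)‖ ^ 2
      = ∑ i ∈ s, ∑ j ∈ s, RCLike.re (c i * starRingEnd 𝕜 (c j)) * (r i * r j) := by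
  have h : ((‖∑ i ∈ s, c i * (r i : 𝕜)‖ ^ 2 : ℝ) : 𝕜)
      = ∑ i ∈ s, ∑ j ∈ s, (c i * starRingEnd 𝕜 (c j)) * ((r i * r j : ℝ) : 𝕜) := by
    push_cast
    rw [← RCLike.mul_conj, map_sum, Finset.sum_mul_sum]
    refine Finset.sum_congr rfl fun i _ => Finset.sum_congr rfl fun j _ => ?_
    rw [map_mul, RCLike.conj_ofReal]
    ring
  have h' := congrArg RCLike.re h
  rw [RCLike.ofReal_re, map_sum] at h'
  rw [h']
  refine Finset.sum_congr rfl fun i _ => ?_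
  rw [map_sum]
  refine Finset.sum_congr rfl fun j _ => ?_
  rw [RCLike.re_mul_ofReal]

/-- The `L²`-norm of a linear combination depends on the Gram matrix only. -/
theorem integral_norm_sq_sum_mul_ofReal {α ι : Type*} [MeasurableSpace α] {μ : Measure α}
    (s : Finset ι) (c : ι → 𝕜) {b : ι → α → ℝ} (hb : ∀ i ∈ s, MemLp (b i) 2 μ) :
    ∫ x, ‖∑ i ∈ s, c i * (b i x : 𝕜)‖ ^ 2 ∂μ
      = ∑ i ∈ s, ∑ j ∈ s, RCLike.re (c i * starRingEnd 𝕜 (c j)) * ∫ x, b i x * b j x ∂μ := by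
  simp_rw [norm_sq_sum_mul_ofReal]
  have hi : ∀ i ∈ s, ∀ j ∈ s, Integrable
      (fun x => RCLike.re (c i * starRingEnd 𝕜 (c j)) * (b i x * b j x)) μ :=
    fun i h j h' => ((hb i h).integrable_mul (hb j h')).const_mul _
  rw [integral_finsetSum _ fun i h => integrable_finsetSum _ fun j h' => hi i h j h']
  refine Finset.sum_congr rfl fun i h => ?_
  rw [integral_finsetSum _ fun j h' => hi i h j h']
  refine Finset.sum_congr rfl fun j _ => ?_
  rw [integral_const_mul]

end Gram

/-! ### Lower boxes as a generating π-system -/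

theorem measurableSet_lowerOrthant {m : ℕ} (x : EuclideanSpace ℝ (Fin m)) :
    MeasurableSet (lowerOrthant x) := by
  have : lowerOrthant x = ⋂ j, {z : EuclideanSpace ℝ (Fin m) | z j ≤ x j} := by
    ext z; simp [lowerOrthant]
  rw [this]
  exact MeasurableSet.iInter fun j => measurableSet_le (by fun_prop) measurable_const

theorem lowerOrthant_inter {m : ℕ} (x y : EuclideanSpace ℝ (Fin m)) :
    lowerOrthant x ∩ lowerOrthant y = lowerOrthant (vecMin x y) := by
  ext z; simp [lowerOrthant, vecMin, forall_and]

section Box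

variable {n : ℕ} {d : Fin n → ℕ}

theorem lowerBox_eq_pi (x : MPoint d) :
    lowerBox x = Set.univ.pi fun i => lowerOrthant (x i) := by
  ext z; simp [lowerBox]

theorem measurableSet_lowerBox (x : MPoint d) : MeasurableSet (lowerBox x) := by
  rw [lowerBox_eq_pi]
  exact MeasurableSet.univ_pi fun i => measurableSet_lowerOrthant _

theorem lowerBox_inter (x y : MPoint d) :
    lowerBox x ∩ lowerBox y = lowerBox fun i => vecMin (x i) (y i) := by
  simp_rw [lowerBox_eq_pi, ← Set.pi_inter_distrib, lowerOrthant_inter]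

theorem isPiSystem_lowerBox : IsPiSystem (Set.range (lowerBox (d := d))) := by
  rintro _ ⟨x, rfl⟩ _ ⟨y, rfl⟩ _
  exact ⟨_, (lowerBox_inter x y).symm⟩

theorem generateFrom_lowerBox :
    (inferInstance : MeasurableSpace (MPoint d))
      = MeasurableSpace.generateFrom (Set.range (lowerBox (d := d))) := by
  classical
  apply le_antisymm
  · have key : ∀ (i : Fin n) (j : Fin (d i)),
        Measurable[MeasurableSpace.generateFrom (Set.range (lowerBox (d := d)))]
          fun z : MPoint d => z i j := by
      intro i j
      refine @measurable_of_Iic ℝ (MPoint d) _ _ _ (_) inferInstance _ _ _ fun q => ?_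
      -- A half-space is the increasing union of boxes with corner `q` in the coordinate `(i, j)`
      -- and `k → ∞` in all the others.
      have : (fun z : MPoint d => z i j) ⁻¹' Set.Iic q
          = ⋃ k : ℕ, lowerBox (fun i' => WithLp.toLp 2 fun j' =>
              if (⟨i', j'⟩ : (i : Fin n) × Fin (d i)) = ⟨i, j⟩ then q else (k : ℝ)) := by
        ext z
        simp only [Set.mem_preimage, Set.mem_Iic, Set.mem_iUnion, lowerBox, lowerOrthant,
          Set.mem_ofPred_eq]
        constructor
        · intro h
          obtain ⟨k, hk⟩ := exists_nat_ge (∑ p : (i : Fin n) × Fin (d i), |z p.1 p.2|)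
          refine ⟨k, fun i' j' => ?_⟩
          split_ifs with e
          · cases e; exact h
          · exact ((le_abs_self _).trans (Finset.single_le_sum
              (f := fun p : (i : Fin n) × Fin (d i) => |z p.1 p.2|)
              (fun _ _ => abs_nonneg _) (Finset.mem_univ ⟨i', j'⟩))).trans hk
        · rintro ⟨k, hk⟩
          simpa using hk i j
      rw [this]
      exact MeasurableSet.iUnion fun k => MeasurableSpace.measurableSet_generateFrom ⟨_, rfl⟩
    have hid : Measurable[MeasurableSpace.generateFrom (Set.range (lowerBox (d := d)))]
        (fun z : MPoint d => z) := by
      refine @measurable_pi_lambda _ _ _ (_) _ _ fun i => ?_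
      have h1 : Measurable[MeasurableSpace.generateFrom (Set.range (lowerBox (d := d)))]
          fun z : MPoint d => WithLp.ofLp (z i) :=
        @measurable_pi_lambda _ _ _ (_) _ _ fun j => key i j
      exact (WithLp.measurable_toLp 2 (Fin (d i) → ℝ)).comp h1
    intro s hs
    exact hid hs
  · refine MeasurableSpace.generateFrom_le ?_
    rintro _ ⟨x, rfl⟩
    exact measurableSet_lowerBox x

end Box

/-! ### Step functions and the noise -/

/-- The step function `∑ c_x 1_{(-∞, x]}`. -/
def stepFun {𝕜 : Type*} [RCLike 𝕜] {n : ℕ} {d : Fin n → ℕ} (c : MPoint d →₀ 𝕜)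
    (z : MPoint d) : 𝕜 :=
  c.sum fun x a => a * (lowerBox x).indicator 1 z

/-- The integral `∑ c_x B x` of the step function `∑ c_x 1_{(-∞, x]}`. -/
def stepNoise {𝕜 : Type*} [RCLike 𝕜] {Ω : Type*} {n : ℕ} {d : Fin n → ℕ}
    (B : MPoint d → Ω → ℝ) (c : MPoint d →₀ 𝕜) (ω : Ω) : 𝕜 :=
  c.sum fun x a => a * (B x ω : 𝕜)

/-- `B` has the second moments of a white noise with control measure `μ`. -/
structure IsOrthantNoise {Ω : Type*} [MeasurableSpace Ω] (P : Measure Ω)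
    {n : ℕ} {d : Fin n → ℕ} (μ : Measure (MPoint d)) (B : MPoint d → Ω → ℝ) : Prop where
  memLp : ∀ x, MemLp (B x) 2 P
  covariance : ∀ x y, ∫ ω, B x ω * B y ω ∂P = μ.real (lowerBox x ∩ lowerBox y)

/-- The product of the distribution functions at `x ∧ y` is the product measure of the intersected
boxes. Gaussianity serves only to give square integrability. -/
theorem IsClockedBrownianSheet.isOrthantNoise {Ω : Type*} [MeasurableSpace Ω] {P : Measure Ω}
    {n : ℕ} {d : Fin n → ℕ} {ν : (i : Fin n) → Measure (EuclideanSpace ℝ (Fin (d i)))}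
    [∀ i, IsProbabilityMeasure (ν i)] {B : MPoint d → Ω → ℝ}
    (hB : IsClockedBrownianSheet P ν B) : IsOrthantNoise P (Measure.pi ν) B where
  memLp x := (hB.gaussian.hasGaussianLaw_eval x).memLp_two
  covariance x y := by
    rw [hB.covariance, lowerBox_inter, lowerBox_eq_pi, measureReal_def, Measure.pi_pi,
      ENNReal.toReal_prod]
    rfl

section Step

variable {𝕜 : Type*} [RCLike 𝕜] {Ω : Type*} {n : ℕ} {d : Fin n → ℕ} {B : MPoint d → Ω → ℝ}

theorem stepFun_add (c c' : MPoint d →₀ 𝕜) : stepFun (c + c') = stepFun c + stepFun c' := by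
  ext z
  exact Finsupp.sum_add_index' (by simp) (by intros; ring)

theorem stepNoise_add (c c' : MPoint d →₀ 𝕜) :
    stepNoise B (c + c') = stepNoise B c + stepNoise B c' := by
  ext z
  exact Finsupp.sum_add_index' (by simp) (by intros; ring)

theorem stepFun_smul (r : 𝕜) (c : MPoint d →₀ 𝕜) : stepFun (r • c) = r • stepFun c := by
  ext z
  simp only [stepFun, Pi.smul_apply, smul_eq_mul]
  rw [Finsupp.sum_smul_index' (by simp), Finsupp.mul_sum]
  exact Finsupp.sum_congr fun x _ => by simp [mul_assoc]

theorem stepNoise_smul (r : 𝕜) (c : MPoint d →₀ 𝕜) :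
    stepNoise B (r • c) = r • stepNoise B c := by
  ext z
  simp only [stepNoise, Pi.smul_apply, smul_eq_mul]
  rw [Finsupp.sum_smul_index' (by simp), Finsupp.mul_sum]
  exact Finsupp.sum_congr fun x _ => by simp [mul_assoc]

theorem stepFun_neg (c : MPoint d →₀ 𝕜) : stepFun (-c) = -stepFun c := by
  rw [← neg_one_smul 𝕜 c, stepFun_smul, neg_one_smul]

theorem stepNoise_neg (c : MPoint d →₀ 𝕜) : stepNoise B (-c) = -stepNoise B c := by
  rw [← neg_one_smul 𝕜 c, stepNoise_smul, neg_one_smul]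

theorem stepFun_sub (c c' : MPoint d →₀ 𝕜) : stepFun (c - c') = stepFun c - stepFun c' := by
  rw [sub_eq_add_neg, stepFun_add, stepFun_neg, sub_eq_add_neg]

theorem stepNoise_sub (c c' : MPoint d →₀ 𝕜) :
    stepNoise B (c - c') = stepNoise B c - stepNoise B c' := by
  rw [sub_eq_add_neg, stepNoise_add, stepNoise_neg, sub_eq_add_neg]

end Step

/-! ### The Wiener integral: contraction, linearity, existence for indicators -/

section Wiener

variable {𝕜 : Type*} [RCLike 𝕜] {Ω : Type*} [MeasurableSpace Ω] {P : Measure Ω}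
  {n : ℕ} {d : Fin n → ℕ} {μ : Measure (MPoint d)} {B : MPoint d → Ω → ℝ}

theorem memLp_indicator_one [IsFiniteMeasure μ] {s : Set (MPoint d)} (hs : MeasurableSet s) :
    MemLp (s.indicator (1 : MPoint d → 𝕜)) 2 μ :=
  memLp_indicator_const 2 hs (1 : 𝕜) (Or.inr (measure_ne_top _ _))

theorem memLp_stepFun [IsFiniteMeasure μ] (c : MPoint d →₀ 𝕜) : MemLp (stepFun c) 2 μ :=
  memLp_finsetSum _ fun x _ => (memLp_indicator_one (measurableSet_lowerBox x)).const_mul _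

theorem memLp_stepNoise (hB : IsOrthantNoise P μ B) (c : MPoint d →₀ 𝕜) :
    MemLp (stepNoise B c) 2 P :=
  memLp_finsetSum _ fun x _ => (hB.memLp x).ofReal.const_mul _

/-- The Itô isometry for step functions. -/
theorem eLpNorm_stepNoise [IsFiniteMeasure μ] (hB : IsOrthantNoise P μ B) (c : MPoint d →₀ 𝕜) :
    eLpNorm (stepNoise B c) 2 P = eLpNorm (stepFun c) 2 μ := by
  have key : ∫ ω, ‖stepNoise B c ω‖ ^ 2 ∂P = ∫ z, ‖stepFun c z‖ ^ 2 ∂μ := by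
    have h1 : ∀ z, stepFun c z = ∑ x ∈ c.support, c x *
        (((lowerBox x).indicator (1 : MPoint d → ℝ) z : ℝ) : 𝕜) := fun z =>
      Finset.sum_congr rfl fun x _ => by
        by_cases hz : z ∈ lowerBox x <;> simp [hz]
    simp_rw [h1]
    rw [integral_norm_sq_sum_mul_ofReal _ _ fun x _ =>
      memLp_indicator_one (measurableSet_lowerBox x)]
    refine (integral_norm_sq_sum_mul_ofReal _ _ fun x _ => hB.memLp x).trans ?_
    refine Finset.sum_congr rfl fun x _ => Finset.sum_congr rfl fun y _ => ?_
    rw [hB.covariance, ← integral_indicator_one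
      ((measurableSet_lowerBox x).inter (measurableSet_lowerBox y))]
    congr 2
    ext z
    simp [Set.inter_indicator_one]
  have h2 : ∫⁻ ω, ‖stepNoise B c ω‖ₑ ^ 2 ∂P = ∫⁻ z, ‖stepFun c z‖ₑ ^ 2 ∂μ := by
    rw [lintegral_enorm_sq_eq (memLp_stepNoise hB c), lintegral_enorm_sq_eq (memLp_stepFun c), key]
  exact le_antisymm (eLpNorm_two_le_of_sq_le h2.le) (eLpNorm_two_le_of_sq_le h2.ge)

theorem isWienerIntegral_iff {f : MPoint d → 𝕜} {I : Ω → 𝕜} :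
    IsWienerIntegral P μ B f I ↔ MemLp f 2 μ ∧ MemLp I 2 P ∧ ∀ ε : ℝ≥0∞, 0 < ε →
      ∃ c : MPoint d →₀ 𝕜, eLpNorm (f - stepFun c) 2 μ < ε ∧ eLpNorm (I - stepNoise B c) 2 P < ε :=
  Iff.rfl

/-- The isometry for step functions passes to the closure. This half of it suffices: applied to
differences, it controls any two versions. -/
theorem IsWienerIntegral.eLpNorm_le [IsFiniteMeasure μ] (hB : IsOrthantNoise P μ B)
    {f : MPoint d → 𝕜} {I : Ω → 𝕜} (h : IsWienerIntegral P μ B f I) :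
    eLpNorm I 2 P ≤ eLpNorm f 2 μ := by
  rw [isWienerIntegral_iff] at h
  obtain ⟨hf, hI, h⟩ := h
  refine ENNReal.le_of_forall_pos_le_add fun ε hε _ => ?_
  obtain ⟨c, h1, h2⟩ := h (ε / 2) (ENNReal.half_pos (by simpa using hε.ne'))
  have e1 : eLpNorm I 2 P ≤ eLpNorm (I - stepNoise B c) 2 P + eLpNorm (stepNoise B c) 2 P := by
    have := eLpNorm_add_le (hI.sub (memLp_stepNoise hB c)).1 (memLp_stepNoise hB c).1 one_le_two
    simpa using this
  have e2 : eLpNorm (stepFun c) 2 μ ≤ eLpNorm f 2 μ + eLpNorm (f - stepFun c) 2 μ := by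
    have := eLpNorm_sub_le (hf.1) (hf.sub (memLp_stepFun c)).1 one_le_two
    simpa using this
  calc eLpNorm I 2 P ≤ ε / 2 + (eLpNorm f 2 μ + ε / 2) := by
        rw [eLpNorm_stepNoise hB] at e1
        exact e1.trans (add_le_add h2.le (e2.trans (by gcongr)))
    _ = eLpNorm f 2 μ + ε := by
        rw [add_left_comm, ENNReal.add_halves]

theorem IsWienerIntegral.lintegral_sq_le [IsFiniteMeasure μ] (hB : IsOrthantNoise P μ B)
    {f : MPoint d → 𝕜} {I : Ω → 𝕜} (h : IsWienerIntegral P μ B f I) :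
    ∫⁻ ω, ‖I ω‖ₑ ^ 2 ∂P ≤ ∫⁻ z, ‖f z‖ₑ ^ 2 ∂μ := by
  rw [← eLpNorm_two_sq, ← eLpNorm_two_sq]
  gcongr
  exact h.eLpNorm_le hB

theorem isWienerIntegral_zero : IsWienerIntegral P μ B (0 : MPoint d → 𝕜) (0 : Ω → 𝕜) := by
  refine ⟨MemLp.zero', MemLp.zero', fun ε hε => ⟨0, ?_, ?_⟩⟩ <;> simpa using hε

theorem IsWienerIntegral.add [IsFiniteMeasure μ] (hB : IsOrthantNoise P μ B)
    {f g : MPoint d → 𝕜} {I J : Ω → 𝕜}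
    (h : IsWienerIntegral P μ B f I) (h' : IsWienerIntegral P μ B g J) :
    IsWienerIntegral P μ B (f + g) (I + J) := by
  rw [isWienerIntegral_iff] at h h' ⊢
  refine ⟨h.1.add h'.1, h.2.1.add h'.2.1, fun ε hε => ?_⟩
  obtain ⟨c, h1, h2⟩ := h.2.2 (ε / 2) (ENNReal.half_pos hε.ne')
  obtain ⟨c', h1', h2'⟩ := h'.2.2 (ε / 2) (ENNReal.half_pos hε.ne')
  refine ⟨c + c', ?_, ?_⟩
  · rw [stepFun_add, add_sub_add_comm]
    refine (eLpNorm_add_le (h.1.sub (memLp_stepFun c)).1 (h'.1.sub (memLp_stepFun c')).1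
      one_le_two).trans_lt ?_
    rw [← ENNReal.add_halves ε]
    exact ENNReal.add_lt_add h1 h1'
  · rw [stepNoise_add, add_sub_add_comm]
    refine (eLpNorm_add_le (h.2.1.sub (memLp_stepNoise hB c)).1
      (h'.2.1.sub (memLp_stepNoise hB c')).1 one_le_two).trans_lt ?_
    rw [← ENNReal.add_halves ε]
    exact ENNReal.add_lt_add h2 h2'

theorem IsWienerIntegral.const_smul {f : MPoint d → 𝕜} {I : Ω → 𝕜}
    (h : IsWienerIntegral P μ B f I) (r : 𝕜) : IsWienerIntegral P μ B (r • f) (r • I) := by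
  rw [isWienerIntegral_iff] at h ⊢
  refine ⟨h.1.const_smul r, h.2.1.const_smul r, fun ε hε => ?_⟩
  -- The summand `1` covers `r = 0`.
  have hpos : 0 < ε / (1 + ‖r‖ₑ) := ENNReal.div_pos hε.ne' (by simp)
  have hlt : ∀ a < ε / (1 + ‖r‖ₑ), ‖r‖ₑ * a < ε := fun a ha => by
    have h1 : ‖r‖ₑ * a ≤ (1 + ‖r‖ₑ) * a := by gcongr; exact le_add_self
    refine h1.trans_lt ?_
    rw [mul_comm]
    exact (ENNReal.lt_div_iff_mul_lt (by simp) (by simp)).1 ha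
  obtain ⟨c, h1, h2⟩ := h.2.2 _ hpos
  refine ⟨r • c, ?_, ?_⟩
  · rw [stepFun_smul, ← smul_sub, eLpNorm_const_smul]
    exact hlt _ h1
  · rw [stepNoise_smul, ← smul_sub, eLpNorm_const_smul]
    exact hlt _ h2

theorem IsWienerIntegral.sub [IsFiniteMeasure μ] (hB : IsOrthantNoise P μ B)
    {f g : MPoint d → 𝕜} {I J : Ω → 𝕜}
    (h : IsWienerIntegral P μ B f I) (h' : IsWienerIntegral P μ B g J) :
    IsWienerIntegral P μ B (f - g) (I - J) := by
  have := h.add hB (h'.const_smul (-1))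
  simpa [sub_eq_add_neg] using this

theorem IsWienerIntegral.sum [IsFiniteMeasure μ] (hB : IsOrthantNoise P μ B) {ι : Type*}
    (s : Finset ι) {f : ι → MPoint d → 𝕜} {I : ι → Ω → 𝕜}
    (h : ∀ a ∈ s, IsWienerIntegral P μ B (f a) (I a)) :
    IsWienerIntegral P μ B (∑ a ∈ s, f a) (∑ a ∈ s, I a) := by
  classical
  induction s using Finset.induction_on with
  | empty => simpa using isWienerIntegral_zero
  | insert a s ha ih =>
    rw [Finset.sum_insert ha, Finset.sum_insert ha]
    exact (h a (by simp)).add hB (ih fun b hb => h b (by simp [hb]))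

/-- Links the real noise `W(A)` of the cells with the complex field `G`. -/
theorem IsWienerIntegral.ofReal {f : MPoint d → ℝ} {I : Ω → ℝ} (h : IsWienerIntegral P μ B f I) :
    IsWienerIntegral P μ B (fun z => (f z : 𝕜)) (fun ω => (I ω : 𝕜)) := by
  rw [isWienerIntegral_iff] at h ⊢
  refine ⟨h.1.ofReal, h.2.1.ofReal, fun ε hε => ?_⟩
  obtain ⟨c, h1, h2⟩ := h.2.2 ε hε
  refine ⟨c.mapRange (fun r : ℝ => (r : 𝕜)) (by simp), ?_, ?_⟩
  · refine lt_of_le_of_lt (le_of_eq ?_) h1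
    refine eLpNorm_congr_norm_ae (ae_of_all _ fun z => ?_)
    rw [Real.norm_eq_abs, ← RCLike.norm_ofReal (K := 𝕜) ((f - stepFun c) z)]
    simp only [stepFun, Pi.sub_apply]
    rw [Finsupp.sum_mapRange_index (by simp)]
    simp only [Finsupp.sum]
    push_cast
    congr 2
    refine Finset.sum_congr rfl fun x _ => ?_
    by_cases hz : z ∈ lowerBox x <;> simp [hz]
  · refine lt_of_le_of_lt (le_of_eq ?_) h2
    refine eLpNorm_congr_norm_ae (ae_of_all _ fun z => ?_)
    rw [Real.norm_eq_abs, ← RCLike.norm_ofReal (K := 𝕜) ((I - stepNoise B c) z)]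
    simp only [stepNoise, Pi.sub_apply]
    rw [Finsupp.sum_mapRange_index (by simp)]
    simp only [Finsupp.sum]
    push_cast
    rfl

/-- A function in the `L²`-closure of the step functions has a Wiener integral. -/
theorem exists_isWienerIntegral_of_approx [IsFiniteMeasure μ] (hB : IsOrthantNoise P μ B)
    {f : MPoint d → 𝕜} (hf : MemLp f 2 μ)
    (h : ∀ ε : ℝ≥0∞, 0 < ε → ∃ c : MPoint d →₀ 𝕜, eLpNorm (f - stepFun c) 2 μ < ε) :
    ∃ I : Ω → 𝕜, IsWienerIntegral P μ B f I := by
  obtain ⟨δ, hδ, hsum⟩ := ENNReal.exists_pos_sum_of_countable (ε := 1) one_ne_zero ℕ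
  -- The completeness criterion asks for a bound by `δ N` for all `p, q ≥ N`. As `δ` need not
  -- decrease, the `n`-th accuracy has to lie below every earlier `δ m / 2`.
  have hmin : ∀ n : ℕ, ∃ e : ℝ≥0∞, 0 < e ∧ ∀ m ≤ n, e ≤ (δ m : ℝ≥0∞) / 2 := fun n => by
    induction n with
    | zero => exact ⟨δ 0 / 2, ENNReal.half_pos (by simpa using (hδ 0).ne'), by simp⟩
    | succ n ih =>
      obtain ⟨e, he, h'⟩ := ih
      refine ⟨min e (δ (n + 1) / 2),
        lt_min he (ENNReal.half_pos (by simpa using (hδ (n + 1)).ne')), fun m hm => ?_⟩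
      rcases Nat.le_succ_iff.1 hm with hm | rfl
      · exact (min_le_left _ _).trans (h' m hm)
      · exact min_le_right _ _
  choose e he hle using hmin
  choose c hc using fun n => h (e n) (he n)
  obtain ⟨I, hI, hlim⟩ := Lp.cauchy_complete_eLpNorm (μ := P) one_le_two
    (f := fun n => stepNoise B (c n)) (fun n => memLp_stepNoise hB _)
    (B := fun n => (δ n : ℝ≥0∞)) (hsum.trans ENNReal.one_lt_top).ne fun N p q hp hq => by
      rw [← stepNoise_sub, eLpNorm_stepNoise hB, stepFun_sub]
      have := eLpNorm_sub_le (hf.sub (memLp_stepFun (c q))).1 (hf.sub (memLp_stepFun (c p))).1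
        one_le_two (μ := μ)
      rw [sub_sub_sub_cancel_left] at this
      refine this.trans_lt ?_
      rw [← ENNReal.add_halves (δ N : ℝ≥0∞)]
      exact ENNReal.add_lt_add ((hc q).trans_le (hle q N hq)) ((hc p).trans_le (hle p N hp))
  refine ⟨I, isWienerIntegral_iff.2 ⟨hf, hI, fun ε hε => ?_⟩⟩
  have hδ0 : Filter.Tendsto (fun n => (δ n : ℝ≥0∞)) Filter.atTop (nhds 0) :=
    ENNReal.tendsto_atTop_zero_of_tsum_ne_top (hsum.trans ENNReal.one_lt_top).ne
  obtain ⟨N, h1, h2⟩ := ((hlim.eventually (gt_mem_nhds hε)).and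
    (hδ0.eventually (gt_mem_nhds hε))).exists
  refine ⟨c N, (hc N).trans ((hle N N le_rfl).trans_lt (ENNReal.half_le_self.trans_lt h2)), ?_⟩
  rwa [← neg_sub, eLpNorm_neg]

/-- Dynkin's π-λ theorem: boxes form a generating π-system, and the sets with approximable indicator
form a λ-system. -/
theorem exists_stepFun_indicator [IsFiniteMeasure μ] {A : Set (MPoint d)}
    (hA : MeasurableSet A) : ∀ ε : ℝ≥0∞, 0 < ε → ∃ c : MPoint d →₀ 𝕜,
      eLpNorm (A.indicator 1 - stepFun c) 2 μ < ε := by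
  -- the set of functions that can be approximated is a closed subspace
  have hadd : ∀ {f g : MPoint d → 𝕜}, MemLp f 2 μ → MemLp g 2 μ →
      (∀ ε : ℝ≥0∞, 0 < ε → ∃ c : MPoint d →₀ 𝕜, eLpNorm (f - stepFun c) 2 μ < ε) →
      (∀ ε : ℝ≥0∞, 0 < ε → ∃ c : MPoint d →₀ 𝕜, eLpNorm (g - stepFun c) 2 μ < ε) →
      ∀ ε : ℝ≥0∞, 0 < ε → ∃ c : MPoint d →₀ 𝕜, eLpNorm (f + g - stepFun c) 2 μ < ε := by
    intro f g hf hg h h' ε hε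
    obtain ⟨c, h1⟩ := h (ε / 2) (ENNReal.half_pos hε.ne')
    obtain ⟨c', h1'⟩ := h' (ε / 2) (ENNReal.half_pos hε.ne')
    refine ⟨c + c', ?_⟩
    rw [stepFun_add, add_sub_add_comm]
    refine (eLpNorm_add_le (hf.sub (memLp_stepFun c)).1 (hg.sub (memLp_stepFun c')).1
      one_le_two).trans_lt ?_
    rw [← ENNReal.add_halves ε]
    exact ENNReal.add_lt_add h1 h1'
  have hneg : ∀ {f : MPoint d → 𝕜},
      (∀ ε : ℝ≥0∞, 0 < ε → ∃ c : MPoint d →₀ 𝕜, eLpNorm (f - stepFun c) 2 μ < ε) →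
      ∀ ε : ℝ≥0∞, 0 < ε → ∃ c : MPoint d →₀ 𝕜, eLpNorm (-f - stepFun c) 2 μ < ε := by
    intro f h ε hε
    obtain ⟨c, h1⟩ := h ε hε
    refine ⟨-c, ?_⟩
    rwa [stepFun_neg, ← neg_sub', eLpNorm_neg]
  have hlim : ∀ {f : MPoint d → 𝕜}, MemLp f 2 μ → (∀ ε : ℝ≥0∞, 0 < ε → ∃ g : MPoint d → 𝕜,
      MemLp g 2 μ ∧ eLpNorm (f - g) 2 μ < ε ∧
      ∀ ε : ℝ≥0∞, 0 < ε → ∃ c : MPoint d →₀ 𝕜, eLpNorm (g - stepFun c) 2 μ < ε) →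
      ∀ ε : ℝ≥0∞, 0 < ε → ∃ c : MPoint d →₀ 𝕜, eLpNorm (f - stepFun c) 2 μ < ε := by
    intro f hf h ε hε
    obtain ⟨g, hg, h1, h2⟩ := h (ε / 2) (ENNReal.half_pos hε.ne')
    obtain ⟨c, h3⟩ := h2 (ε / 2) (ENNReal.half_pos hε.ne')
    refine ⟨c, ?_⟩
    have := eLpNorm_add_le (hf.sub hg).1 (hg.sub (memLp_stepFun c)).1 one_le_two (μ := μ)
    rw [sub_add_sub_cancel] at this
    refine this.trans_lt ?_
    rw [← ENNReal.add_halves ε]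
    exact ENNReal.add_lt_add h1 h3
  have hbox : ∀ x : MPoint d, ∀ ε : ℝ≥0∞, 0 < ε → ∃ c : MPoint d →₀ 𝕜,
      eLpNorm ((lowerBox x).indicator 1 - stepFun c) 2 μ < ε := by
    intro x ε hε
    refine ⟨Finsupp.single x 1, ?_⟩
    have : stepFun (Finsupp.single x (1 : 𝕜)) = (lowerBox x).indicator 1 := by
      ext z; simp [stepFun]
    simpa [this] using hε
  have hunion : ∀ s : ℕ → Set (MPoint d), Monotone s → (∀ k, MeasurableSet (s k)) →
      (∀ k, ∀ ε : ℝ≥0∞, 0 < ε → ∃ c : MPoint d →₀ 𝕜,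
        eLpNorm ((s k).indicator 1 - stepFun c) 2 μ < ε) →
      ∀ ε : ℝ≥0∞, 0 < ε → ∃ c : MPoint d →₀ 𝕜,
        eLpNorm ((⋃ k, s k).indicator 1 - stepFun c) 2 μ < ε := by
    intro s hs hm h
    refine hlim (memLp_indicator_one (.iUnion hm)) fun ε hε => ?_
    -- The `L²` distance of the indicators is the square root of this measure, which tends to zero
    -- by continuity from above.
    have h0 : Filter.Tendsto (fun k => μ ((⋃ k, s k) \ s k)) Filter.atTop (nhds 0) := by
      have := tendsto_measure_iInter_atTop (μ := μ) (s := fun k => (⋃ k, s k) \ s k)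
        (fun k => ((MeasurableSet.iUnion hm).diff (hm k)).nullMeasurableSet)
        (fun i j hij => Set.sdiff_subset_sdiff_right (hs hij)) ⟨0, measure_ne_top _ _⟩
      rwa [← Set.sdiff_iUnion, Set.sdiff_self, measure_empty] at this
    have h1 : Filter.Tendsto (fun k => μ ((⋃ k, s k) \ s k) ^ (1 / (2 : ℝ≥0∞).toReal))
        Filter.atTop (nhds 0) := by
      have := h0.ennrpow_const (1 / (2 : ℝ≥0∞).toReal)
      simpa using this
    obtain ⟨k, hk⟩ := (h1.eventually (gt_mem_nhds hε)).exists
    refine ⟨(s k).indicator 1, memLp_indicator_one (hm k), ?_, h k⟩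
    rw [← Set.indicator_sdiff (Set.subset_iUnion s k)]
    have := eLpNorm_indicator_const (μ := μ) (p := 2) (c := (1 : 𝕜))
      ((MeasurableSet.iUnion hm).diff (hm k)) (by simp) (by simp)
    change eLpNorm (((⋃ k, s k) \ s k).indicator fun _ => (1 : 𝕜)) 2 μ < ε
    rw [this]
    simpa using hk
  -- The constant `1` is needed for complements; it is reached through boxes exhausting the space.
  have huniv : ∀ ε : ℝ≥0∞, 0 < ε → ∃ c : MPoint d →₀ 𝕜,
      eLpNorm ((Set.univ : Set (MPoint d)).indicator 1 - stepFun c) 2 μ < ε := by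
    have : (Set.univ : Set (MPoint d))
        = ⋃ k : ℕ, lowerBox fun i => WithLp.toLp 2 fun _ => (k : ℝ) := by
      refine (Set.eq_univ_of_forall fun z => Set.mem_iUnion.2 ?_).symm
      obtain ⟨k, hk⟩ := exists_nat_ge (∑ p : (i : Fin n) × Fin (d i), |z p.1 p.2|)
      exact ⟨k, fun i j => ((le_abs_self _).trans (Finset.single_le_sum
              (f := fun p : (i : Fin n) × Fin (d i) => |z p.1 p.2|)
              (fun _ _ => abs_nonneg _) (Finset.mem_univ ⟨i, j⟩))).trans hk⟩
    rw [this]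
    refine hunion _ (fun k l hkl z hz i j => (hz i j).trans ?_)
      (fun k => measurableSet_lowerBox _) fun k => hbox _
    simpa using hkl
  induction A, hA using MeasurableSpace.induction_on_inter generateFrom_lowerBox
    isPiSystem_lowerBox with
  | empty =>
    intro ε hε
    refine ⟨0, ?_⟩
    have h0 : stepFun (0 : MPoint d →₀ 𝕜) = 0 := by ext z; simp [stepFun]
    rw [h0, sub_zero, Set.indicator_empty']
    simpa using hε
  | basic t ht =>
    obtain ⟨x, rfl⟩ := ht
    exact hbox x
  | compl t ht ih =>
    have := hadd (memLp_indicator_one .univ) (memLp_indicator_one ht).neg huniv (hneg ih)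
    rwa [← sub_eq_add_neg, ← Set.indicator_sdiff (Set.subset_univ t), ← Set.compl_eq_univ_sdiff]
      at this
  | iUnion s hd hm ih =>
    -- Partial unions turn the disjoint union into a monotone one, to which `hunion` applies.
    have hacc : ∀ k, MeasurableSet (Set.accumulate s k) := fun k =>
      MeasurableSet.biUnion (Set.to_countable _) fun i _ => hm i
    rw [← Set.iUnion_accumulate]
    refine hunion _ Set.monotone_accumulate
      hacc fun k => ?_
    induction k with
    | zero => simpa using ih 0
    | succ k ihk =>
      rw [Set.accumulate_succ, Set.indicator_union_of_disjoint
        (Set.disjoint_accumulate hd (Nat.lt_succ_self k))]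
      exact hadd (memLp_indicator_one (hacc k))
        (memLp_indicator_one (hm _)) ihk (ih _)

/-- Ensures that `W(A)` is never the default value `0` of `wienerIntegral` for lack of an integral.
-/
theorem isWienerIntegral_wienerIntegral [IsFiniteMeasure μ] (hB : IsOrthantNoise P μ B)
    {A : Set (MPoint d)} (hA : MeasurableSet A) :
    IsWienerIntegral P μ B (A.indicator 1) (wienerIntegral P μ B (A.indicator 1)) := by
  have h : ∃ I : Ω → ℝ, IsWienerIntegral P μ B (A.indicator 1) I :=
    exists_isWienerIntegral_of_approx hB (memLp_indicator_one hA) (exists_stepFun_indicator hA)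
  rw [wienerIntegral, dif_pos h]
  exact h.choose_spec

end Wiener

/-! ### Hilbert-valued fields and averaging over partitions -/

theorem measurable_of_measurable_edist {α X : Type*} [MeasurableSpace α] [PseudoEMetricSpace X]
    [SecondCountableTopology X] [MeasurableSpace X] [BorelSpace X] {f : α → X}
    (h : ∀ y, Measurable fun a => edist (f a) y) : Measurable f := by
  refine measurable_of_isOpen fun U hU => ?_
  choose! r hr hrU using fun x (hx : x ∈ U) => EMetric.isOpen_iff.1 hU x hx
  -- By the Lindelöf property countably many balls cover `U`, and preimages of balls involve
  -- distances to fixed points only.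
  obtain ⟨C, hC, hCU⟩ := TopologicalSpace.isOpen_iUnion_countable
    (fun x : U => Metric.eball (x : X) (r x)) fun x => Metric.isOpen_eball
  have hU' : U = ⋃ x ∈ C, Metric.eball (x : X) (r x) := by
    rw [hCU]
    refine Set.Subset.antisymm (fun x hx => Set.mem_iUnion.2 ⟨⟨x, hx⟩, ?_⟩)
      (Set.iUnion_subset fun x => hrU x x.2)
    exact Metric.mem_eball_self (hr x hx)
  rw [hU', Set.preimage_iUnion₂]
  exact MeasurableSet.biUnion hC fun x _ => measurableSet_lt (h x) measurable_const

section Mean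

variable {α : Type*} [MeasurableSpace α]

/-- The mean is the best constant approximation in `L²`. -/
theorem lintegral_enorm_sub_average_sq_le {ν : Measure α} [IsFiniteMeasure ν] {f : α → ℂ}
    (hf : MemLp f 2 ν) (c : ℂ) :
    ∫⁻ z, ‖f z - ⨍ y, f y ∂ν‖ₑ ^ 2 ∂ν ≤ ∫⁻ z, ‖f z - c‖ₑ ^ 2 ∂ν := by
  set m := ⨍ y, f y ∂ν with hm
  have h1 : MemLp (fun z => f z - m) 2 ν := hf.sub (memLp_const m)
  have h2 : MemLp (fun z => f z - c) 2 ν := hf.sub (memLp_const c)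
  have i1 : Integrable (fun z => f z - m) ν := h1.integrable one_le_two
  rw [lintegral_enorm_sq_eq h1, lintegral_enorm_sq_eq h2]
  refine ENNReal.ofReal_le_ofReal ?_
  have i3 : Integrable (fun z => ‖f z - m‖ ^ 2) ν := (memLp_two_iff_integrable_sq_norm h1.1).1 h1
  have i4 : Integrable (fun z => 2 * ((f z - m) * starRingEnd ℂ (m - c)).re) ν :=
    ((i1.mul_const _).re).const_mul 2
  have e : ∀ z, ‖f z - c‖ ^ 2
      = ‖f z - m‖ ^ 2 + 2 * ((f z - m) * starRingEnd ℂ (m - c)).re + ‖m - c‖ ^ 2 := fun z => by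
    have : f z - c = (f z - m) + (m - c) := by ring
    rw [this, Complex.sq_norm, Complex.sq_norm, Complex.sq_norm, Complex.normSq_add]
    ring
  have hre : ∫ z, ((f z - m) * starRingEnd ℂ (m - c)).re ∂ν = 0 := by
    have := integral_re (𝕜 := ℂ) (i1.mul_const (starRingEnd ℂ (m - c)))
    refine this.trans ?_
    rw [integral_mul_const, hm, integral_sub_average]
    simp
  simp_rw [e]
  have i34 : Integrable
      (fun z => ‖f z - m‖ ^ 2 + 2 * ((f z - m) * starRingEnd ℂ (m - c)).re) ν := i3.add i4
  rw [integral_add i34 (integrable_const _), integral_add i3 i4, integral_const_mul, hre]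
  have : 0 ≤ ∫ _, ‖m - c‖ ^ 2 ∂ν := integral_nonneg fun _ => by positivity
  linarith

/-- The mean of `f` over the cell of label `a` of the partition `π`. -/
def cellMean (μ : Measure α) {k : ℕ} (π : α → Fin k) (f : α → ℂ) (a : Fin k) : ℂ :=
  ⨍ z in π ⁻¹' {a}, f z ∂μ

theorem lintegral_eq_sum_cells {μ : Measure α} {k : ℕ} {π : α → Fin k} (hπ : Measurable π)
    (g : α → ℝ≥0∞) : ∫⁻ z, g z ∂μ = ∑ a, ∫⁻ z in π ⁻¹' {a}, g z ∂μ := by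
  have h := lintegral_iUnion (μ := μ) (s := fun a => π ⁻¹' {a})
    (fun a => hπ (measurableSet_singleton a)) (fun a b hab => Set.disjoint_left.2
      fun z (h : π z = a) (h' : π z = b) => hab (h.symm.trans h')) g
  rwa [tsum_fintype, Set.iUnion_eq_univ_iff.2 fun z => ⟨π z, rfl⟩, Measure.restrict_univ] at h

/-- Cell means are the orthogonal projection onto the functions of `π`. This makes later bounds
uniform over all refinements. -/
theorem lintegral_sub_cellMean_sq_le {μ : Measure α} [IsFiniteMeasure μ] {f : α → ℂ}
    (hf : MemLp f 2 μ) {k : ℕ} {π : α → Fin k} (hπ : Measurable π) (c : Fin k → ℂ) :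
    ∫⁻ z, ‖f z - cellMean μ π f (π z)‖ₑ ^ 2 ∂μ ≤ ∫⁻ z, ‖f z - c (π z)‖ₑ ^ 2 ∂μ := by
  rw [lintegral_eq_sum_cells hπ, lintegral_eq_sum_cells hπ]
  refine Finset.sum_le_sum fun a _ => ?_
  have hm : MeasurableSet (π ⁻¹' {a}) := hπ (measurableSet_singleton a)
  calc ∫⁻ z in π ⁻¹' {a}, ‖f z - cellMean μ π f (π z)‖ₑ ^ 2 ∂μ
      = ∫⁻ z in π ⁻¹' {a}, ‖f z - cellMean μ π f a‖ₑ ^ 2 ∂μ :=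
        setLIntegral_congr_fun hm fun z (hz : π z = a) => by simp only [hz]
    _ ≤ ∫⁻ z in π ⁻¹' {a}, ‖f z - c a‖ₑ ^ 2 ∂μ :=
        lintegral_enorm_sub_average_sq_le (hf.restrict _) _
    _ = ∫⁻ z in π ⁻¹' {a}, ‖f z - c (π z)‖ₑ ^ 2 ∂μ :=
        setLIntegral_congr_fun hm fun z (hz : π z = a) => by simp only [hz]

end Mean

section Field

variable {α T : Type*} [MeasurableSpace α] [MeasurableSpace T] {μ : Measure α} {τ : Measure T}

/-- The hypotheses on a family `e x ∈ L²(τ)`, `x ∈ α`, that make it an element of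
`L²(μ; L²(τ))`, with all sections square integrable. -/
structure IsSquareField (μ : Measure α) (τ : Measure T) (e : α → T → ℂ) : Prop where
  measurable : Measurable (Function.uncurry e)
  memLp_left : ∀ x, MemLp (e x) 2 τ
  memLp_right : ∀ t, MemLp (fun x => e x t) 2 μ
  lintegral_lt_top : ∫⁻ x, ∫⁻ t, ‖e x t‖ₑ ^ 2 ∂τ ∂μ < ∞

variable {e : α → T → ℂ}

/-- `L²(τ)` is separable, so distances to fixed `g` decide measurability; these are integrals
depending measurably on `x` by Tonelli. -/
theorem IsSquareField.measurable_toLp [SFinite τ] [MeasurableSpace.CountablyGenerated T]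
    (he : IsSquareField μ τ e) :
    @Measurable _ _ _ (borel _) fun x => (he.memLp_left x).toLp (e x) := by
  let _ : MeasurableSpace (Lp ℂ 2 τ) := borel _
  have : BorelSpace (Lp ℂ 2 τ) := ⟨rfl⟩
  have : Fact ((2 : ℝ≥0∞) ≠ ∞) := ⟨by simp⟩
  refine measurable_of_measurable_edist fun g => ?_
  have h : ∀ x, edist ((he.memLp_left x).toLp (e x)) g
      = (∫⁻ t, ‖e x t - g t‖ₑ ^ 2 ∂τ) ^ (1 / 2 : ℝ) := fun x => by
    rw [Lp.edist_def, ← eLpNorm_two_sq (fun t => e x t - g t) τ,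
      ← ENNReal.rpow_natCast, ← ENNReal.rpow_mul]
    norm_num
    refine eLpNorm_congr_ae ?_
    filter_upwards [(he.memLp_left x).coeFn_toLp] with t ht
    simp [ht]
  simp_rw [h]
  refine Measurable.pow_const (Measurable.lintegral_prod_right' (f := fun p : α × T =>
    ‖e p.1 p.2 - g p.2‖ₑ ^ 2) ?_) _
  have h1 : Measurable fun p : α × T => e p.1 p.2 := he.measurable
  have h2 : Measurable g := (Lp.stronglyMeasurable g).measurable
  exact ((h1.sub (h2.comp measurable_snd)).enorm).pow_const 2

theorem IsSquareField.enorm_toLp_sq (he : IsSquareField μ τ e) (x : α) :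
    ‖(he.memLp_left x).toLp (e x)‖ₑ ^ 2 = ∫⁻ t, ‖e x t‖ₑ ^ 2 ∂τ := by
  rw [Lp.enorm_toLp, eLpNorm_two_sq]

theorem IsSquareField.enorm_integral_mul_conj_sq_le (he : IsSquareField μ τ e)
    (x y : α) : ‖∫ t, e x t * starRingEnd ℂ (e y t) ∂τ‖ₑ ^ 2
      ≤ (∫⁻ t, ‖e x t‖ₑ ^ 2 ∂τ) * ∫⁻ t, ‖e y t‖ₑ ^ 2 ∂τ := by
  -- The inner product is conjugate-linear in its first argument, hence the swapped order. The claim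
  -- is then Cauchy–Schwarz.
  have h : ∫ t, e x t * starRingEnd ℂ (e y t) ∂τ
      = inner ℂ ((he.memLp_left y).toLp (e y)) ((he.memLp_left x).toLp (e x)) := by
    rw [L2.inner_def]
    refine integral_congr_ae ?_
    filter_upwards [(he.memLp_left x).coeFn_toLp, (he.memLp_left y).coeFn_toLp] with t h1 h2
    rw [h1, h2, RCLike.inner_apply]
  rw [h, ← he.enorm_toLp_sq, ← he.enorm_toLp_sq, ← mul_pow, mul_comm]
  gcongr
  rw [← ofReal_norm, ← ofReal_norm, ← ofReal_norm, ← ENNReal.ofReal_mul (norm_nonneg _)]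
  exact ENNReal.ofReal_le_ofReal (norm_inner_le_norm _ _)

theorem IsSquareField.memLp_toLp [SFinite τ] [MeasurableSpace.CountablyGenerated T]
    (he : IsSquareField μ τ e) : MemLp (fun x => (he.memLp_left x).toLp (e x)) 2 μ := by
  let _ : MeasurableSpace (Lp ℂ 2 τ) := borel _
  have : BorelSpace (Lp ℂ 2 τ) := ⟨rfl⟩
  have : Fact ((2 : ℝ≥0∞) ≠ ∞) := ⟨by simp⟩
  refine ⟨he.measurable_toLp.aestronglyMeasurable, ?_⟩
  have h : eLpNorm (fun x => (he.memLp_left x).toLp (e x)) 2 μ ^ 2 < ∞ := by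
    rw [eLpNorm_two_sq]
    simp_rw [he.enorm_toLp_sq]
    exact he.lintegral_lt_top
  exact (ENNReal.pow_lt_top_iff.1 h).resolve_right two_ne_zero

/-- The cell means of a square integrable field over sufficiently fine partitions approximate
the field in `L²(μ ⊗ τ)`. -/
theorem IsSquareField.exists_partition [IsFiniteMeasure μ] [SFinite τ]
    [MeasurableSpace.CountablyGenerated T] (he : IsSquareField μ τ e) {ε : ℝ≥0∞} (hε : 0 < ε) :
    ∃ (k₀ : ℕ) (π₀ : α → Fin k₀), Measurable π₀ ∧
      ∀ (k : ℕ) (π : α → Fin k), Measurable π → (∃ r : Fin k → Fin k₀, π₀ = r ∘ π) →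
        ∫⁻ t, ∫⁻ x, ‖e x t - cellMean μ π (fun y => e y t) (π x)‖ₑ ^ 2 ∂μ ∂τ ≤ ε := by
  -- An error below `min 1 ε` has square at most `ε`. The cells of `π₀` are the level sets of `s`.
  obtain ⟨s, hs, -⟩ := he.memLp_toLp.exists_simpleFunc_eLpNorm_sub_lt (by simp)
    (ε := min 1 ε) (lt_min one_pos hε).ne'
  let v : Fin s.range.card → Lp ℂ 2 τ := fun a => (s.range.equivFin.symm a).1
  let π₀ : α → Fin s.range.card := fun x => s.range.equivFin ⟨s x, s.mem_range_self x⟩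
  have hv : ∀ x, v (π₀ x) = s x := fun x => by simp [v, π₀]
  have hπ₀ : Measurable π₀ := by
    refine measurable_to_countable' fun a => ?_
    have : π₀ ⁻¹' {a} = s ⁻¹' {v a} := by
      ext x
      simp only [Set.mem_preimage, Set.mem_singleton_iff, ← hv]
      exact ⟨fun h => by rw [h], fun h => s.range.equivFin.symm.injective (Subtype.ext h)⟩
    rw [this]
    exact s.measurableSet_fiber _
  refine ⟨_, π₀, hπ₀, fun k π hπ ⟨r, hr⟩ => ?_⟩
  have hmv : Measurable fun p : T × α => (v (π₀ p.2) : T → ℂ) p.1 := by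
    have h1 : Measurable fun p : Fin s.range.card × T => (v p.1 : T → ℂ) p.2 :=
      measurable_from_prod_countable_right fun a => (Lp.stronglyMeasurable (v a)).measurable
    exact h1.comp ((hπ₀.comp measurable_snd).prodMk measurable_fst)
  have hme : Measurable fun p : T × α => e p.2 p.1 := he.measurable.comp measurable_swap
  calc ∫⁻ t, ∫⁻ x, ‖e x t - cellMean μ π (fun y => e y t) (π x)‖ₑ ^ 2 ∂μ ∂τ
      ≤ ∫⁻ t, ∫⁻ x, ‖e x t - v (π₀ x) t‖ₑ ^ 2 ∂μ ∂τ := by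
        refine lintegral_mono fun t => ?_
        -- Since `π` refines `π₀`, the simple function is a competitor that is constant on the cells
        -- of `π`.
        have := lintegral_sub_cellMean_sq_le (he.memLp_right t) hπ fun a => v (r a) t
        simpa [hr] using this
    _ = ∫⁻ x, ∫⁻ t, ‖e x t - v (π₀ x) t‖ₑ ^ 2 ∂τ ∂μ :=
        lintegral_lintegral_swap ((hme.sub hmv).enorm.pow_const 2).aemeasurable
    _ = ∫⁻ x, ‖(he.memLp_left x).toLp (e x) - s x‖ₑ ^ 2 ∂μ := by
        refine lintegral_congr fun x => ?_
        rw [Lp.enorm_def, eLpNorm_two_sq]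
        refine lintegral_congr_ae ?_
        filter_upwards [(he.memLp_left x).coeFn_toLp,
          Lp.coeFn_sub ((he.memLp_left x).toLp (e x)) (s x)] with t h1 h2
        rw [h2, Pi.sub_apply, h1, hv]
    _ ≤ ε := by
        have h2 := eLpNorm_two_sq ((fun x => (he.memLp_left x).toLp (e x)) - ⇑s) μ
        simp only [Pi.sub_apply] at h2
        rw [← h2, sq]
        calc _ ≤ 1 * ε := mul_le_mul' (hs.le.trans (min_le_left _ _))
              (hs.le.trans (min_le_right _ _))
          _ = ε := one_mul ε

end Field

/-! ### Gram kernels and their double Riemann sums -/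

section Kernel

variable {α T : Type*} [MeasurableSpace α] [MeasurableSpace T] {τ : Measure T} [SFinite τ]
  {e : α → T → ℂ}

/-- From `|ab| ≤ |a|² + |b|²` and finiteness of the masses. Two measures are allowed so that `μ` may
be restricted to two different cells. -/
theorem integrable_mul_conj {μ₁ μ₂ : Measure α} [IsFiniteMeasure μ₁] [IsFiniteMeasure μ₂]
    (hm : Measurable (Function.uncurry e))
    (h₁ : ∫⁻ x, ∫⁻ t, ‖e x t‖ₑ ^ 2 ∂τ ∂μ₁ < ∞) (h₂ : ∫⁻ x, ∫⁻ t, ‖e x t‖ₑ ^ 2 ∂τ ∂μ₂ < ∞) :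
    Integrable (fun p : (α × α) × T => e p.1.1 p.2 * starRingEnd ℂ (e p.1.2 p.2))
      ((μ₁.prod μ₂).prod τ) := by
  have m1 : Measurable fun p : (α × α) × T => e p.1.1 p.2 :=
    hm.comp (measurable_fst.fst.prodMk measurable_snd)
  have m2 : Measurable fun p : (α × α) × T => e p.1.2 p.2 :=
    hm.comp (measurable_fst.snd.prodMk measurable_snd)
  have m3 : Measurable fun p : (α × α) × T => e p.1.1 p.2 * starRingEnd ℂ (e p.1.2 p.2) :=
    m1.mul (Complex.continuous_conj.measurable.comp m2)
  have m4 : Measurable fun x => ∫⁻ t, ‖e x t‖ₑ ^ 2 ∂τ :=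
    Measurable.lintegral_prod_right' (f := fun p : α × T => ‖e p.1 p.2‖ₑ ^ 2)
      (hm.enorm.pow_const 2)
  refine ⟨m3.aestronglyMeasurable, ?_⟩
  rw [hasFiniteIntegral_iff_enorm, lintegral_prod _ m3.enorm.aemeasurable]
  calc ∫⁻ z : α × α, ∫⁻ t, ‖e z.1 t * starRingEnd ℂ (e z.2 t)‖ₑ ∂τ ∂(μ₁.prod μ₂)
      ≤ ∫⁻ z : α × α, ((∫⁻ t, ‖e z.1 t‖ₑ ^ 2 ∂τ) + ∫⁻ t, ‖e z.2 t‖ₑ ^ 2 ∂τ) ∂(μ₁.prod μ₂) := by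
        refine lintegral_mono fun z => ?_
        have m5 : Measurable fun t => ‖e z.1 t‖ₑ ^ 2 :=
          (hm.comp measurable_prodMk_left).enorm.pow_const 2
        rw [← lintegral_add_left m5]
        refine lintegral_mono fun t => ?_
        rw [enorm_mul, RCLike.enorm_conj]
        rcases le_total ‖e z.1 t‖ₑ ‖e z.2 t‖ₑ with h | h
        · exact le_add_left (by rw [sq]; gcongr)
        · exact le_add_right (by rw [sq]; gcongr)
    _ = (∫⁻ x, ∫⁻ t, ‖e x t‖ₑ ^ 2 ∂τ ∂μ₁) * μ₂ Set.univ
        + μ₁ Set.univ * ∫⁻ x, ∫⁻ t, ‖e x t‖ₑ ^ 2 ∂τ ∂μ₂ := by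
        have m5 : Measurable fun z : α × α => ∫⁻ t, ‖e z.1 t‖ₑ ^ 2 ∂τ := m4.comp measurable_fst
        rw [lintegral_add_left m5]
        congr 1
        · rw [lintegral_prod _ m5.aemeasurable]
          simp [lintegral_mul_const _ m4]
        · have m6 : Measurable fun z : α × α => ∫⁻ t, ‖e z.2 t‖ₑ ^ 2 ∂τ := m4.comp measurable_snd
          rw [lintegral_prod _ m6.aemeasurable]
          simp [mul_comm]
    _ < ∞ := ENNReal.add_lt_top.2 ⟨ENNReal.mul_lt_top h₁ (measure_lt_top _ _),
        ENNReal.mul_lt_top (measure_lt_top _ _) h₂⟩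

variable {K : α → α → ℝ}

/-- Fubini. If a measure vanishes, both sides are `0`, in accord with the convention for null cells.
-/
theorem average_prod_mul_conj {μ₁ μ₂ : Measure α} [IsFiniteMeasure μ₁] [IsFiniteMeasure μ₂]
    (hm : Measurable (Function.uncurry e))
    (h₁ : ∫⁻ x, ∫⁻ t, ‖e x t‖ₑ ^ 2 ∂τ ∂μ₁ < ∞) (h₂ : ∫⁻ x, ∫⁻ t, ‖e x t‖ₑ ^ 2 ∂τ ∂μ₂ < ∞)
    (hK : ∀ x y, (K x y : ℂ) = ∫ t, e x t * starRingEnd ℂ (e y t) ∂τ) :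
    Integrable (fun t => (⨍ x, e x t ∂μ₁) * starRingEnd ℂ (⨍ y, e y t ∂μ₂)) τ ∧
    ((⨍ z : α × α, K z.1 z.2 ∂(μ₁.prod μ₂) : ℝ) : ℂ)
      = ∫ t, (⨍ x, e x t ∂μ₁) * starRingEnd ℂ (⨍ y, e y t ∂μ₂) ∂τ := by
  have hi := integrable_mul_conj (τ := τ) hm h₁ h₂
  have e1 : ∀ t, ∫ z : α × α, e z.1 t * starRingEnd ℂ (e z.2 t) ∂(μ₁.prod μ₂)
      = (∫ x, e x t ∂μ₁) * starRingEnd ℂ (∫ y, e y t ∂μ₂) := fun t => by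
    rw [integral_prod_mul (fun x => e x t) (fun y => starRingEnd ℂ (e y t)), integral_conj]
  have e2 : ∀ t, (⨍ x, e x t ∂μ₁) * starRingEnd ℂ (⨍ y, e y t ∂μ₂)
      = (((μ₁.real Set.univ)⁻¹ * (μ₂.real Set.univ)⁻¹ : ℝ) : ℂ) *
        ∫ z : α × α, e z.1 t * starRingEnd ℂ (e z.2 t) ∂(μ₁.prod μ₂) := fun t => by
    rw [e1, average_eq, average_eq, Complex.real_smul, Complex.real_smul, map_mul,
      Complex.conj_ofReal]
    push_cast
    ring
  simp_rw [e2]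
  refine ⟨hi.integral_prod_right.const_mul _, ?_⟩
  rw [integral_const_mul, ← integral_integral_swap hi, average_eq, smul_eq_mul,
    ← Set.univ_prod_univ, measureReal_prod_prod, mul_inv, Complex.ofReal_mul]
  simp_rw [← hK]
  rw [integral_complex_ofReal]

theorem IsSquareField.memLp_kernel {μ : Measure α} [SFinite μ] (he : IsSquareField μ τ e)
    (hK : ∀ x y, (K x y : ℂ) = ∫ t, e x t * starRingEnd ℂ (e y t) ∂τ) :
    MemLp (fun z : α × α => K z.1 z.2) 2 (μ.prod μ) := by
  have m1 : Measurable fun p : (α × α) × T => e p.1.1 p.2 :=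
    he.measurable.comp (measurable_fst.fst.prodMk measurable_snd)
  have m2 : Measurable fun p : (α × α) × T => e p.1.2 p.2 :=
    he.measurable.comp (measurable_fst.snd.prodMk measurable_snd)
  have m3 : StronglyMeasurable fun p : (α × α) × T => e p.1.1 p.2 * starRingEnd ℂ (e p.1.2 p.2) :=
    (m1.mul (Complex.continuous_conj.measurable.comp m2)).stronglyMeasurable
  have m4 : Measurable fun x => ∫⁻ t, ‖e x t‖ₑ ^ 2 ∂τ :=
    Measurable.lintegral_prod_right' (f := fun p : α × T => ‖e p.1 p.2‖ₑ ^ 2)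
      (he.measurable.enorm.pow_const 2)
  have hm : Measurable fun z : α × α => K z.1 z.2 := by
    have := Complex.measurable_re.comp (m3.integral_prod_right' (ν := τ)).measurable
    simpa only [Function.comp_def, ← hK, Complex.ofReal_re] using this
  refine ⟨hm.aestronglyMeasurable, ?_⟩
  have h : eLpNorm (fun z : α × α => K z.1 z.2) 2 (μ.prod μ) ^ 2 < ∞ := by
    rw [eLpNorm_two_sq]
    calc ∫⁻ z : α × α, ‖K z.1 z.2‖ₑ ^ 2 ∂(μ.prod μ)
        ≤ ∫⁻ z : α × α, (∫⁻ t, ‖e z.1 t‖ₑ ^ 2 ∂τ) * ∫⁻ t, ‖e z.2 t‖ₑ ^ 2 ∂τ ∂(μ.prod μ) := by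
          refine lintegral_mono fun z => ?_
          have := he.enorm_integral_mul_conj_sq_le z.1 z.2
          rwa [← hK, ← ofReal_norm, Complex.norm_real, ofReal_norm] at this
      _ = (∫⁻ x, ∫⁻ t, ‖e x t‖ₑ ^ 2 ∂τ ∂μ) * ∫⁻ x, ∫⁻ t, ‖e x t‖ₑ ^ 2 ∂τ ∂μ :=
          lintegral_prod_mul m4.aemeasurable m4.aemeasurable
      _ < ∞ := ENNReal.mul_lt_top he.lintegral_lt_top he.lintegral_lt_top
  exact (ENNReal.pow_lt_top_iff.1 h).resolve_right two_ne_zero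

theorem integrable_cellMean_mul_conj {μ : Measure α} [IsFiniteMeasure μ]
    (he : IsSquareField μ τ e)
    (hK : ∀ x y, (K x y : ℂ) = ∫ t, e x t * starRingEnd ℂ (e y t) ∂τ)
    {k : ℕ} (π : α → Fin k) (a b : Fin k) :
    Integrable (fun t => cellMean μ π (fun y => e y t) a *
      starRingEnd ℂ (cellMean μ π (fun y => e y t) b)) τ ∧
    (⨍ z in (π ⁻¹' {a}) ×ˢ (π ⁻¹' {b}), K z.1 z.2 ∂(μ.prod μ))
      = ∫ t, (cellMean μ π (fun y => e y t) a *
          starRingEnd ℂ (cellMean μ π (fun y => e y t) b)).re ∂τ := by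
  have hlt : ∀ s : Set α, ∫⁻ x in s, ∫⁻ t, ‖e x t‖ₑ ^ 2 ∂τ ∂μ < ∞ := fun s =>
    (setLIntegral_le_lintegral _ _).trans_lt he.lintegral_lt_top
  obtain ⟨h1, h2⟩ := average_prod_mul_conj he.measurable (hlt (π ⁻¹' {a})) (hlt (π ⁻¹' {b})) hK
  refine ⟨h1, ?_⟩
  rw [← Measure.prod_restrict, ← Complex.ofReal_re (⨍ z : α × α, K z.1 z.2 ∂_), h2]
  exact (integral_re (𝕜 := ℂ) h1).symm

/-- The Wiener integral `∑ a, (mean of e · t over cell a) w_a` of the cell means. -/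
def cellField (μ : Measure α) (e : α → T → ℂ) {k : ℕ} (π : α → Fin k) (w : Fin k → ℝ) (t : T) : ℂ :=
  ∑ a, cellMean μ π (fun y => e y t) a * (w a : ℂ)

/-- Expanding the square and integrating in `t` turns products of cell means into cell averages of
`K`. The weights `w` are arbitrary, so this holds for every path. -/
theorem integral_norm_sq_cellField {μ : Measure α} [IsFiniteMeasure μ]
    (he : IsSquareField μ τ e)
    (hK : ∀ x y, (K x y : ℂ) = ∫ t, e x t * starRingEnd ℂ (e y t) ∂τ)
    {k : ℕ} (π : α → Fin k) (w : Fin k → ℝ) :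
    Integrable (fun t => ‖cellField μ e π w t‖ ^ 2) τ ∧
    ∫ t, ‖cellField μ e π w t‖ ^ 2 ∂τ
      = ∑ a, ∑ b, (⨍ z in (π ⁻¹' {a}) ×ˢ (π ⁻¹' {b}), K z.1 z.2 ∂(μ.prod μ)) * w a * w b := by
  have hi : ∀ a b, Integrable (fun t => (cellMean μ π (fun y => e y t) a *
      starRingEnd ℂ (cellMean μ π (fun y => e y t) b)).re * (w a * w b)) τ := fun a b =>
    ((integrable_cellMean_mul_conj he hK π a b).1.re).mul_const _
  have heq : ∀ t, ‖cellField μ e π w t‖ ^ 2 = ∑ a, ∑ b, (cellMean μ π (fun y => e y t) a *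
      starRingEnd ℂ (cellMean μ π (fun y => e y t) b)).re * (w a * w b) := fun t =>
    norm_sq_sum_mul_ofReal Finset.univ (fun a => cellMean μ π (fun y => e y t) a) w
  simp_rw [heq]
  refine ⟨integrable_finsetSum _ fun a _ => integrable_finsetSum _ fun b _ => hi a b, ?_⟩
  rw [integral_finsetSum _ fun a _ => integrable_finsetSum _ fun b _ => hi a b]
  refine Finset.sum_congr rfl fun a _ => ?_
  rw [integral_finsetSum _ fun b _ => hi a b]
  refine Finset.sum_congr rfl fun b _ => ?_
  rw [integral_mul_const, (integrable_cellMean_mul_conj he hK π a b).2, mul_assoc]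

end Kernel

/-! ### Comparison of squared norms -/

section Convergence

variable {Ω T : Type*} [MeasurableSpace Ω] [MeasurableSpace T] {P : Measure Ω} {τ : Measure T}

/-- Young's inequality for the cross term `2 ‖a - b‖ ‖a‖`. Only the size of `a`, later the fixed
field `G`, enters besides the difference. -/
theorem enorm_sq_sub_sq_le (a b : ℂ) {η : ℝ} (hη : 0 < η) :
    ‖‖b‖ ^ 2 - ‖a‖ ^ 2‖ₑ ≤ ENNReal.ofReal (1 + 1 / η) * ‖a - b‖ₑ ^ 2
      + ENNReal.ofReal η * ‖a‖ₑ ^ 2 := by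
  rw [← ofReal_norm (a - b), ← ofReal_norm a, ← ENNReal.ofReal_pow (norm_nonneg _),
    ← ENNReal.ofReal_pow (norm_nonneg _), ← ENNReal.ofReal_mul (by positivity),
    ← ENNReal.ofReal_mul hη.le, ← ENNReal.ofReal_add (by positivity) (by positivity),
    ← ofReal_norm, Real.norm_eq_abs]
  refine ENNReal.ofReal_le_ofReal ?_
  set x := ‖a - b‖
  set y := ‖a‖
  have h1 : |‖b‖ - y| ≤ x := by
    rw [abs_sub_comm]; exact abs_norm_sub_norm_le a b
  have h2 : ‖b‖ ^ 2 - y ^ 2 = (‖b‖ - y) ^ 2 + 2 * (‖b‖ - y) * y := by ring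
  have hx : 0 ≤ x := norm_nonneg _
  have hy : 0 ≤ y := norm_nonneg _
  have h3 : 2 * x * y ≤ 1 / η * x ^ 2 + η * y ^ 2 := by
    have h4 : 0 ≤ (x - η * y) ^ 2 / η := by positivity
    have h5 : (x - η * y) ^ 2 / η = 1 / η * x ^ 2 + η * y ^ 2 - 2 * x * y := by
      field_simp; ring
    linarith
  rw [h2]
  calc |(‖b‖ - y) ^ 2 + 2 * (‖b‖ - y) * y| ≤ |(‖b‖ - y) ^ 2| + |2 * (‖b‖ - y) * y| := abs_add_le _ _
    _ = |‖b‖ - y| ^ 2 + 2 * |‖b‖ - y| * y := by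
        rw [abs_pow, abs_mul, abs_mul, abs_of_nonneg hy, abs_two]
    _ ≤ x ^ 2 + 2 * x * y := by gcongr
    _ ≤ _ := by linarith

theorem lintegral_enorm_integral_sq_sub_le [SFinite P] [SFinite τ] {g h : T → Ω → ℂ}
    (hg : AEStronglyMeasurable (Function.uncurry g) (τ.prod P))
    (hh : AEStronglyMeasurable (Function.uncurry h) (τ.prod P))
    (hgi : ∀ᵐ ω ∂P, Integrable (fun t => ‖g t ω‖ ^ 2) τ)
    (hhi : ∀ᵐ ω ∂P, Integrable (fun t => ‖h t ω‖ ^ 2) τ) {η : ℝ} (hη : 0 < η) :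
    ∫⁻ ω, ‖∫ t, ‖h t ω‖ ^ 2 ∂τ - ∫ t, ‖g t ω‖ ^ 2 ∂τ‖ₑ ∂P
      ≤ ENNReal.ofReal (1 + 1 / η) * ∫⁻ t, ∫⁻ ω, ‖g t ω - h t ω‖ₑ ^ 2 ∂P ∂τ
        + ENNReal.ofReal η * ∫⁻ t, ∫⁻ ω, ‖g t ω‖ₑ ^ 2 ∂P ∂τ := by
  have m1 : AEMeasurable (fun p : T × Ω => ‖g p.1 p.2 - h p.1 p.2‖ₑ ^ 2) (τ.prod P) :=
    (hg.sub hh).enorm.pow_const 2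
  have m2 : AEMeasurable (fun p : T × Ω => ‖g p.1 p.2‖ₑ ^ 2) (τ.prod P) := hg.enorm.pow_const 2
  have m1' : AEMeasurable (fun p : Ω × T => ‖g p.2 p.1 - h p.2 p.1‖ₑ ^ 2) (P.prod τ) := m1.prod_swap
  have m2' : AEMeasurable (fun p : Ω × T => ‖g p.2 p.1‖ₑ ^ 2) (P.prod τ) := m2.prod_swap
  have s1 := lintegral_lintegral_swap (f := fun t ω => ‖g t ω - h t ω‖ₑ ^ 2) m1
  have s2 := lintegral_lintegral_swap (f := fun t ω => ‖g t ω‖ₑ ^ 2) m2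
  rw [s1, s2, ← lintegral_const_mul'' _ m1'.lintegral_prod_right',
    ← lintegral_const_mul'' _ m2'.lintegral_prod_right',
    ← lintegral_add_left' (m1'.lintegral_prod_right'.const_mul _)]
  refine lintegral_mono_ae ?_
  filter_upwards [hgi, hhi, m1'.aestronglyMeasurable.prodMk_left,
    m2'.aestronglyMeasurable.prodMk_left] with ω h1 h2 h3 h4
  rw [← integral_sub h2 h1, ← lintegral_const_mul'' _ h3.aemeasurable,
    ← lintegral_const_mul'' _ h4.aemeasurable,
    ← lintegral_add_left' (h3.aemeasurable.const_mul _)]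
  exact (enorm_integral_le_lintegral_enorm _).trans
    (lintegral_mono fun t => enorm_sq_sub_sq_le _ _ hη)

end Convergence

/-! ### Negative definite functions and centered characters -/

theorem one_sub_cos_sub_le (a b : ℝ) :
    1 - Real.cos (a - b) ≤ 2 * (1 - Real.cos a) + 2 * (1 - Real.cos b) := by
  rw [Real.cos_sub]
  -- The difference of the two sides is `|exp (i a) + exp (i b) - 2|² / 2`.
  nlinarith [sq_nonneg (Real.cos a + Real.cos b - 2), sq_nonneg (Real.sin a + Real.sin b),
    Real.sin_sq_add_cos_sq a, Real.sin_sq_add_cos_sq b]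

/-- The centered character `x ↦ exp (i x · t) - E exp (i X · t)`. -/
def centeredChar {m : ℕ} (ν : Measure (EuclideanSpace ℝ (Fin m)))
    (x t : EuclideanSpace ℝ (Fin m)) : ℂ :=
  Complex.exp (((inner ℝ x t : ℝ) : ℂ) * Complex.I) - charFun ν t

section Psi

variable {m : ℕ} {ρ ν : Measure (EuclideanSpace ℝ (Fin m))}

theorem exp_inner_sub (x y t : EuclideanSpace ℝ (Fin m)) :
    Complex.exp (((inner ℝ (x - y) t : ℝ) : ℂ) * Complex.I)
      = Complex.exp (((inner ℝ x t : ℝ) : ℂ) * Complex.I)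
        * starRingEnd ℂ (Complex.exp (((inner ℝ y t : ℝ) : ℂ) * Complex.I)) := by
  rw [← Complex.exp_conj, ← Complex.exp_add, inner_sub_left]
  congr 1
  simp only [map_mul, Complex.conj_ofReal, Complex.conj_I]
  push_cast
  ring

theorem integrable_one_sub_cos
    (hρ : ∫⁻ t, ENNReal.ofReal (min 1 (‖t‖ ^ 2)) ∂ρ < ∞) (x : EuclideanSpace ℝ (Fin m)) :
    Integrable (fun t => 1 - Real.cos (inner ℝ x t)) ρ := by
  have h0 : Integrable (fun t : EuclideanSpace ℝ (Fin m) => min 1 (‖t‖ ^ 2)) ρ := by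
    refine ⟨by fun_prop, ?_⟩
    rwa [hasFiniteIntegral_iff_ofReal (ae_of_all _ fun _ => by positivity)]
  -- The `2` bounds `1 - cos` for large `t`; `‖x‖ ^ 2` covers the bound `(x · t)² / 2` for small
  -- `t`.
  refine (h0.const_mul (2 + ‖x‖ ^ 2)).mono' (by fun_prop) (ae_of_all _ fun t => ?_)
  rw [Real.norm_eq_abs, abs_of_nonneg (by linarith [Real.cos_le_one (inner ℝ x t)])]
  rcases le_total 1 (‖t‖ ^ 2) with h | h
  · rw [min_eq_left h]
    nlinarith [Real.neg_one_le_cos (inner ℝ x t), sq_nonneg ‖x‖]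
  · rw [min_eq_right h]
    have h1 := Real.one_sub_sq_div_two_le_cos (x := inner ℝ x t)
    have h2 : (inner ℝ x t) ^ 2 ≤ (‖x‖ * ‖t‖) ^ 2 :=
      sq_le_sq' (by linarith [neg_abs_le (inner ℝ x t), abs_real_inner_le_norm x t])
        (real_inner_le_norm x t)
    nlinarith [sq_nonneg ‖t‖, sq_nonneg (‖x‖ * ‖t‖)]

theorem psiFun_nonneg (x : EuclideanSpace ℝ (Fin m)) : 0 ≤ psiFun ρ x :=
  integral_nonneg fun _ => sub_nonneg.2 (Real.cos_le_one _)

theorem psiFun_sub_le (hρ : ∫⁻ t, ENNReal.ofReal (min 1 (‖t‖ ^ 2)) ∂ρ < ∞)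
    (x y : EuclideanSpace ℝ (Fin m)) : psiFun ρ (x - y) ≤ 2 * psiFun ρ x + 2 * psiFun ρ y := by
  unfold psiFun
  rw [← integral_const_mul, ← integral_const_mul, ← integral_add
    ((integrable_one_sub_cos hρ x).const_mul 2) ((integrable_one_sub_cos hρ y).const_mul 2)]
  refine integral_mono (integrable_one_sub_cos hρ _)
    (((integrable_one_sub_cos hρ x).const_mul 2).add ((integrable_one_sub_cos hρ y).const_mul 2))
    fun t => ?_
  simp only [inner_sub_left]
  exact one_sub_cos_sub_le _ _

theorem measurable_psiFun [SFinite ρ] : Measurable (psiFun ρ) := by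
  have h : StronglyMeasurable fun p : EuclideanSpace ℝ (Fin m) × EuclideanSpace ℝ (Fin m) =>
      1 - Real.cos (inner ℝ p.1 p.2) := by
    apply Continuous.stronglyMeasurable
    fun_prop
  exact (h.integral_prod_right' (ν := ρ)).measurable

/-- Fubini for a nonnegative integrand. It serves all three expectations in `centeredPsi`, with `g`
a shift, a reflected shift and a difference. -/
theorem integral_psiFun_comp [SFinite ρ] (hρ : ∫⁻ t, ENNReal.ofReal (min 1 (‖t‖ ^ 2)) ∂ρ < ∞)
    {β : Type*} [MeasurableSpace β] {κ : Measure β} [IsProbabilityMeasure κ]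
    {g : β → EuclideanSpace ℝ (Fin m)} (hg : Measurable g)
    (hi : Integrable (fun b => psiFun ρ (g b)) κ) :
    Integrable (fun t => 1 - (∫ b, Complex.exp (((inner ℝ (g b) t : ℝ) : ℂ) * Complex.I) ∂κ).re) ρ ∧
    ∫ b, psiFun ρ (g b) ∂κ
      = ∫ t, (1 - (∫ b, Complex.exp (((inner ℝ (g b) t : ℝ) : ℂ) * Complex.I) ∂κ).re) ∂ρ := by
  have hm : Measurable fun p : β × EuclideanSpace ℝ (Fin m) =>
      1 - Real.cos (inner ℝ (g p.1) p.2) := by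
    fun_prop
  have hint : Integrable (fun p : β × EuclideanSpace ℝ (Fin m) =>
      1 - Real.cos (inner ℝ (g p.1) p.2)) (κ.prod ρ) := by
    rw [integrable_prod_iff hm.aestronglyMeasurable]
    refine ⟨ae_of_all _ fun b => integrable_one_sub_cos hρ (g b), ?_⟩
    have h : (fun b => ∫ t, ‖1 - Real.cos (inner ℝ (g b) t)‖ ∂ρ) = fun b => psiFun ρ (g b) := by
      ext b
      refine integral_congr_ae (ae_of_all _ fun t => ?_)
      exact Real.norm_of_nonneg (sub_nonneg.2 (Real.cos_le_one _))
    rw [← h] at hi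
    exact hi
  have hexp : ∀ t, Integrable
      (fun b => Complex.exp (((inner ℝ (g b) t : ℝ) : ℂ) * Complex.I)) κ := fun t => by
    refine Integrable.of_bound (C := 1) ?_ (ae_of_all _ fun b => ?_)
    · exact Measurable.aestronglyMeasurable (by fun_prop)
    · rw [Complex.norm_exp_ofReal_mul_I]
  have heq : ∀ t, ∫ b, (1 - Real.cos (inner ℝ (g b) t)) ∂κ
      = 1 - (∫ b, Complex.exp (((inner ℝ (g b) t : ℝ) : ℂ) * Complex.I) ∂κ).re := fun t => by
    have h1 := integral_re (𝕜 := ℂ) (hexp t)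
    have h2 : Integrable (fun b => Real.cos (inner ℝ (g b) t)) κ :=
      (hexp t).re.congr (ae_of_all _ fun b => Complex.exp_ofReal_mul_I_re _)
    rw [integral_sub (integrable_const _) h2, integral_const, probReal_univ, one_smul]
    congr 1
    refine Eq.trans ?_ h1
    exact integral_congr_ae (ae_of_all _ fun b => (Complex.exp_ofReal_mul_I_re _).symm)
  simp_rw [← heq]
  exact ⟨hint.integral_prod_right, integral_integral_swap hint⟩

theorem measurable_centeredChar [IsFiniteMeasure ν] :
    Measurable (Function.uncurry (centeredChar ν)) := by
  have h : Measurable (charFun ν) := measurable_charFun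
  unfold centeredChar Function.uncurry
  fun_prop

theorem centeredChar_neg (x t : EuclideanSpace ℝ (Fin m)) :
    centeredChar ν x (-t) = starRingEnd ℂ (centeredChar ν x t) := by
  rw [centeredChar, centeredChar, charFun_neg, map_sub, ← Complex.exp_conj, inner_neg_right]
  simp

variable [SFinite ρ] [IsProbabilityMeasure ν]

theorem norm_centeredChar_le (x t : EuclideanSpace ℝ (Fin m)) : ‖centeredChar ν x t‖ ≤ 2 := by
  refine (norm_sub_le _ _).trans ?_
  rw [Complex.norm_exp_ofReal_mul_I]
  linarith [norm_charFun_le_one (μ := ν) (t := t)]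

theorem integrable_psiFun_sub_const (hρ : ∫⁻ t, ENNReal.ofReal (min 1 (‖t‖ ^ 2)) ∂ρ < ∞)
    (hψ : Integrable (psiFun ρ) ν) (y : EuclideanSpace ℝ (Fin m)) :
    Integrable (fun u => psiFun ρ (u - y)) ν := by
  refine ((hψ.const_mul 2).add (integrable_const (2 * psiFun ρ y))).mono'
    (measurable_psiFun.comp (measurable_id.sub_const y)).aestronglyMeasurable
    (ae_of_all _ fun u => ?_)
  rw [Real.norm_of_nonneg (psiFun_nonneg _)]
  exact psiFun_sub_le hρ u y

theorem integrable_psiFun_const_sub (hρ : ∫⁻ t, ENNReal.ofReal (min 1 (‖t‖ ^ 2)) ∂ρ < ∞)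
    (hψ : Integrable (psiFun ρ) ν) (x : EuclideanSpace ℝ (Fin m)) :
    Integrable (fun v => psiFun ρ (x - v)) ν := by
  refine ((integrable_const (2 * psiFun ρ x)).add (hψ.const_mul 2)).mono'
    (measurable_psiFun.comp (measurable_id.const_sub x)).aestronglyMeasurable
    (ae_of_all _ fun u => ?_)
  rw [Real.norm_of_nonneg (psiFun_nonneg _)]
  exact psiFun_sub_le hρ x u

theorem integrable_psiFun_prod_sub (hρ : ∫⁻ t, ENNReal.ofReal (min 1 (‖t‖ ^ 2)) ∂ρ < ∞)
    (hψ : Integrable (psiFun ρ) ν) :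
    Integrable (fun w : EuclideanSpace ℝ (Fin m) × EuclideanSpace ℝ (Fin m) =>
      psiFun ρ (w.1 - w.2)) (ν.prod ν) := by
  refine (((hψ.comp_fst ν).const_mul 2).add ((hψ.comp_snd ν).const_mul 2)).mono'
    (measurable_psiFun.comp (measurable_fst.sub measurable_snd)).aestronglyMeasurable
    (ae_of_all _ fun w => ?_)
  rw [Real.norm_of_nonneg (psiFun_nonneg _)]
  exact psiFun_sub_le hρ _ _

theorem integral_re_centeredChar_mul_conj
    (hρ : ∫⁻ t, ENNReal.ofReal (min 1 (‖t‖ ^ 2)) ∂ρ < ∞)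
    (hψ : Integrable (psiFun ρ) ν) (x y : EuclideanSpace ℝ (Fin m)) :
    Integrable (fun t => (centeredChar ν x t * starRingEnd ℂ (centeredChar ν y t)).re) ρ ∧
    centeredPsi ρ ν x y
      = ∫ t, (centeredChar ν x t * starRingEnd ℂ (centeredChar ν y t)).re ∂ρ := by
  obtain ⟨i1, h1⟩ := integral_psiFun_comp hρ (g := fun u => u - y)
    (measurable_id.sub_const y)    (integrable_psiFun_sub_const hρ hψ y)
  obtain ⟨i2, h2⟩ := integral_psiFun_comp hρ (g := fun v => x - v)
    (measurable_id.const_sub x)    (integrable_psiFun_const_sub hρ hψ x)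
  obtain ⟨i3, h3⟩ := integral_psiFun_comp hρ
    (g := fun w : EuclideanSpace ℝ (Fin m) × EuclideanSpace ℝ (Fin m) => w.1 - w.2)
    (measurable_fst.sub measurable_snd)    (integrable_psiFun_prod_sub hρ hψ)
  have i0 : Integrable (fun t => -(1 - Real.cos (inner ℝ (x - y) t))) ρ :=
    (integrable_one_sub_cos hρ (x - y)).neg
  have e1 : ∀ t, ∫ u, Complex.exp (((inner ℝ (u - y) t : ℝ) : ℂ) * Complex.I) ∂ν
      = charFun ν t * starRingEnd ℂ (Complex.exp (((inner ℝ y t : ℝ) : ℂ) * Complex.I)) :=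
    fun t => by simp_rw [exp_inner_sub]; rw [integral_mul_const, charFun_apply]
  have e2 : ∀ t, ∫ v, Complex.exp (((inner ℝ (x - v) t : ℝ) : ℂ) * Complex.I) ∂ν
      = Complex.exp (((inner ℝ x t : ℝ) : ℂ) * Complex.I) * starRingEnd ℂ (charFun ν t) :=
    fun t => by
      simp_rw [exp_inner_sub]; rw [integral_const_mul, integral_conj, charFun_apply]
  have e3 : ∀ t, ∫ w : EuclideanSpace ℝ (Fin m) × EuclideanSpace ℝ (Fin m),
      Complex.exp (((inner ℝ (w.1 - w.2) t : ℝ) : ℂ) * Complex.I) ∂(ν.prod ν)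
      = charFun ν t * starRingEnd ℂ (charFun ν t) :=
    fun t => by
      simp_rw [exp_inner_sub]
      rw [integral_prod_mul
        (fun u => Complex.exp (((inner ℝ u t : ℝ) : ℂ) * Complex.I))
        (fun v => starRingEnd ℂ (Complex.exp (((inner ℝ v t : ℝ) : ℂ) * Complex.I))),
        integral_conj, charFun_apply]
  simp only [e1] at i1 h1
  simp only [e2] at i2 h2
  simp only [e3] at i3 h3
  -- The four terms of the product are each completed to `1 - Re`, the added ones cancelling by
  -- sign. As `ρ` may be infinite, only the completed terms are known to be integrable.
  have key : ∀ t, (centeredChar ν x t * starRingEnd ℂ (centeredChar ν y t)).re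
      = -(1 - Real.cos (inner ℝ (x - y) t))
        + (1 - (charFun ν t * starRingEnd ℂ
            (Complex.exp (((inner ℝ y t : ℝ) : ℂ) * Complex.I))).re)
        + (1 - (Complex.exp (((inner ℝ x t : ℝ) : ℂ) * Complex.I)
            * starRingEnd ℂ (charFun ν t)).re)
        - (1 - (charFun ν t * starRingEnd ℂ (charFun ν t)).re) := fun t => by
    rw [← Complex.exp_ofReal_mul_I_re, exp_inner_sub, centeredChar, centeredChar, map_sub]
    simp only [sub_mul, mul_sub, Complex.sub_re]
    ring
  have j1 := i0.add i1
  have j2 := j1.add i2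
  simp_rw [key]
  refine ⟨j2.sub i3, ?_⟩
  rw [centeredPsi, h1, h2, h3, psiFun, ← integral_neg]
  rw [← integral_add i0 i1]
  refine Eq.trans ?_ (integral_sub j2 i3).symm
  congr 1
  exact (integral_add j1 i2).symm

theorem memLp_centeredChar (hρ : ∫⁻ t, ENNReal.ofReal (min 1 (‖t‖ ^ 2)) ∂ρ < ∞)
    (hψ : Integrable (psiFun ρ) ν) (x : EuclideanSpace ℝ (Fin m)) :
    MemLp (centeredChar ν x) 2 ρ := by
  have hm : Measurable (centeredChar ν x) := measurable_centeredChar.of_uncurry_left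
  rw [memLp_two_iff_integrable_sq_norm hm.aestronglyMeasurable]
  refine (integral_re_centeredChar_mul_conj hρ hψ x x).1.congr (ae_of_all _ fun t => ?_)
  simp only [Complex.mul_conj, Complex.ofReal_re, Complex.normSq_eq_norm_sq]

theorem integral_norm_sq_centeredChar (hρ : ∫⁻ t, ENNReal.ofReal (min 1 (‖t‖ ^ 2)) ∂ρ < ∞)
    (hψ : Integrable (psiFun ρ) ν) (x : EuclideanSpace ℝ (Fin m)) :
    ∫ t, ‖centeredChar ν x t‖ ^ 2 ∂ρ = centeredPsi ρ ν x x := by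
  rw [(integral_re_centeredChar_mul_conj hρ hψ x x).2]
  refine integral_congr_ae (ae_of_all _ fun t => ?_)
  simp only [Complex.mul_conj, Complex.ofReal_re, Complex.normSq_eq_norm_sq]

/-- The spectral representation of the doubly centered kernel. -/
theorem ofReal_centeredPsi (hsymm : ρ.map (fun t => -t) = ρ)
    (hρ : ∫⁻ t, ENNReal.ofReal (min 1 (‖t‖ ^ 2)) ∂ρ < ∞)
    (hψ : Integrable (psiFun ρ) ν) (x y : EuclideanSpace ℝ (Fin m)) :
    (centeredPsi ρ ν x y : ℂ)
      = ∫ t, centeredChar ν x t * starRingEnd ℂ (centeredChar ν y t) ∂ρ := by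
  have hi : Integrable (fun t => centeredChar ν x t * starRingEnd ℂ (centeredChar ν y t)) ρ :=
    (memLp_centeredChar hρ hψ x).integrable_mul (memLp_centeredChar hρ hψ y).star
  -- The reflection `t ↦ -t` conjugates the integrand, so symmetry of `ρ` makes the integral real.
  have hconj : starRingEnd ℂ (∫ t, centeredChar ν x t * starRingEnd ℂ (centeredChar ν y t) ∂ρ)
      = ∫ t, centeredChar ν x t * starRingEnd ℂ (centeredChar ν y t) ∂ρ := by
    have hmap : ρ.map (MeasurableEquiv.neg (EuclideanSpace ℝ (Fin m))) = ρ := hsymm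
    conv_rhs => rw [← hmap]
    rw [(MeasurableEquiv.neg (EuclideanSpace ℝ (Fin m))).measurableEmbedding.integral_map (μ := ρ), ← integral_conj]
    refine integral_congr_ae (ae_of_all _ fun t => ?_)
    simp [centeredChar_neg]
  rw [← Complex.conj_eq_iff_re.1 hconj, (integral_re_centeredChar_mul_conj hρ hψ x y).2]
  congr 1
  exact integral_re (𝕜 := ℂ) hi

theorem lintegral_centeredChar_lt_top (hρ : ∫⁻ t, ENNReal.ofReal (min 1 (‖t‖ ^ 2)) ∂ρ < ∞)
    (hψ : Integrable (psiFun ρ) ν) :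
    ∫⁻ x, ∫⁻ t, ‖centeredChar ν x t‖ₑ ^ 2 ∂ρ ∂ν < ∞ := by
  set C := ∫ u, psiFun ρ u ∂ν
  -- On the diagonal the two subtracted terms of `centeredPsi` are dropped; each of the others is at
  -- most `2 ψ(x) + 2 C`.
  have h : Integrable (fun x => 4 * psiFun ρ x + 4 * C) ν :=
    (hψ.const_mul 4).add (integrable_const _)
  refine lt_of_le_of_lt (lintegral_mono fun x => ?_) h.lintegral_lt_top
  rw [lintegral_enorm_sq_eq (memLp_centeredChar hρ hψ x), integral_norm_sq_centeredChar hρ hψ]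
  refine ENNReal.ofReal_le_ofReal ?_
  have h1 : ∫ u, psiFun ρ (u - x) ∂ν ≤ 2 * C + 2 * psiFun ρ x := by
    have := integral_mono (integrable_psiFun_sub_const hρ hψ x)
      ((hψ.const_mul 2).add (integrable_const (2 * psiFun ρ x))) fun u => psiFun_sub_le hρ u x
    refine this.trans (le_of_eq ?_)
    simp only [Pi.add_apply]
    rw [integral_add (hψ.const_mul 2) (integrable_const _), integral_const_mul, integral_const]
    simp [C]
  have h2 : ∫ u, psiFun ρ (x - u) ∂ν ≤ 2 * psiFun ρ x + 2 * C := by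
    have := integral_mono (integrable_psiFun_const_sub hρ hψ x)
      ((integrable_const (2 * psiFun ρ x)).add (hψ.const_mul 2)) fun u => psiFun_sub_le hρ x u
    refine this.trans (le_of_eq ?_)
    simp only [Pi.add_apply]
    rw [integral_add (integrable_const _) (hψ.const_mul 2), integral_const, integral_const_mul 2]
    simp [C]
  have h3 : 0 ≤ psiFun ρ (x - x) := psiFun_nonneg _
  have h4 : 0 ≤ ∫ w : EuclideanSpace ℝ (Fin m) × EuclideanSpace ℝ (Fin m),
      psiFun ρ (w.1 - w.2) ∂(ν.prod ν) := integral_nonneg fun w => psiFun_nonneg _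
  rw [centeredPsi]
  linarith

end Psi

/-! ### Convergence of the double sums -/

/-- The field of the cell means of `e` is the Wiener integral of the projection of `e` to the
functions that are constant on the cells. -/
theorem isWienerIntegral_cellField {n : ℕ} {d : Fin n → ℕ} {Ω T : Type*} [MeasurableSpace Ω]
    {P : Measure Ω} {μ : Measure (MPoint d)} [IsFiniteMeasure μ] {B : MPoint d → Ω → ℝ}
    {e : MPoint d → T → ℂ} (hB : IsOrthantNoise P μ B) {k : ℕ}
    {π : MPoint d → Fin k} (hπ : Measurable π) (t : T) :
    IsWienerIntegral P μ B (fun x => cellMean μ π (fun y => e y t) (π x))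
      (fun ω => cellField μ e π (fun a => wienerIntegral P μ B ((π ⁻¹' {a}).indicator 1) ω) t) := by
  have h := IsWienerIntegral.sum hB Finset.univ fun a _ =>
    ((isWienerIntegral_wienerIntegral hB (hπ (measurableSet_singleton a))).ofReal
      (𝕜 := ℂ)).const_smul (cellMean μ π (fun y => e y t) a)
  convert h using 1
  · ext x
    rw [Finset.sum_apply, Finset.sum_eq_single (π x)]
    · simp
    · intro b _ hb
      have : x ∉ π ⁻¹' {b} := fun h => hb (Eq.symm h)
      simp [this]
    · simp
  · ext ω
    simp [cellField]

section Limit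

variable {n : ℕ} {d : Fin n → ℕ} {Ω T : Type*} [MeasurableSpace Ω] [MeasurableSpace T]
  {P : Measure Ω} {μ : Measure (MPoint d)} {τ : Measure T} {B : MPoint d → Ω → ℝ}
  {e : MPoint d → T → ℂ}

theorem measurable_cellMean [IsFiniteMeasure μ] (hm : Measurable (Function.uncurry e)) {k : ℕ}
    (π : MPoint d → Fin k) (a : Fin k) : Measurable fun t => cellMean μ π (fun y => e y t) a := by
  simp_rw [cellMean, average_eq]
  exact (hm.stronglyMeasurable.integral_prod_left'
    (μ := μ.restrict (π ⁻¹' {a}))).measurable.const_smul _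

variable [IsFiniteMeasure μ] [SFinite τ] {K : MPoint d → MPoint d → ℝ}
  {G : T → Ω → ℂ}

theorem lintegral_wiener_field_lt_top (hB : IsOrthantNoise P μ B) (he : IsSquareField μ τ e)
    (hG : ∀ t, IsWienerIntegral P μ B (fun x => e x t) (G t)) :
    ∫⁻ t, ∫⁻ ω, ‖G t ω‖ₑ ^ 2 ∂P ∂τ < ∞ := by
  refine (lintegral_mono fun t => (hG t).lintegral_sq_le hB).trans_lt ?_
  have := lintegral_lintegral_swap (μ := μ) (ν := τ) (f := fun x t => ‖e x t‖ₑ ^ 2)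
    (he.measurable.enorm.pow_const 2).aemeasurable
  rw [← this]
  exact he.lintegral_lt_top

theorem ae_integrable_wiener_field (hB : IsOrthantNoise P μ B) (he : IsSquareField μ τ e)
    [SFinite P] (hGm : Measurable (Function.uncurry G))
    (hG : ∀ t, IsWienerIntegral P μ B (fun x => e x t) (G t)) :
    ∀ᵐ ω ∂P, Integrable (fun t => ‖G t ω‖ ^ 2) τ := by
  have hm : Measurable fun p : Ω × T => ‖G p.2 p.1‖ₑ ^ 2 :=
    (hGm.comp measurable_swap).enorm.pow_const 2
  have h : ∫⁻ ω, ∫⁻ t, ‖G t ω‖ₑ ^ 2 ∂τ ∂P < ∞ := by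
    rw [lintegral_lintegral_swap (f := fun ω t => ‖G t ω‖ₑ ^ 2) hm.aemeasurable]
    exact lintegral_wiener_field_lt_top hB he hG
  filter_upwards [ae_lt_top hm.lintegral_prod_right' h.ne] with ω hω
  refine ⟨((hGm.comp measurable_prodMk_right).norm.pow_const 2).aestronglyMeasurable, ?_⟩
  rw [hasFiniteIntegral_iff_enorm]
  simpa [enorm_pow] using hω

/-- The squared `L²(τ)`-norm of the Wiener integrals of a square integrable field is the double
integral of the Gram kernel of the field. -/
theorem isDoubleIntegral_norm_sq [SFinite P] [MeasurableSpace.CountablyGenerated T]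
    (hB : IsOrthantNoise P μ B) (he : IsSquareField μ τ e)
    (hK : ∀ x y, (K x y : ℂ) = ∫ t, e x t * starRingEnd ℂ (e y t) ∂τ)
    (hGm : Measurable (Function.uncurry G))
    (hG : ∀ t, IsWienerIntegral P μ B (fun x => e x t) (G t)) :
    IsDoubleIntegral P μ B K fun ω => ∫ t, ‖G t ω‖ ^ 2 ∂τ := by
  have hQ : AEStronglyMeasurable (fun ω => ∫ t, ‖G t ω‖ ^ 2 ∂τ) P :=
    (StronglyMeasurable.integral_prod_left' (μ := τ) (f := fun p : T × Ω => ‖G p.1 p.2‖ ^ 2)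
      (hGm.norm.pow_const 2).stronglyMeasurable).aestronglyMeasurable
  refine ⟨he.memLp_kernel hK, hQ, fun ε hε δ hδ => ?_⟩
  set M := ∫⁻ t, ∫⁻ ω, ‖G t ω‖ₑ ^ 2 ∂P ∂τ
  have hM : M < ∞ := lintegral_wiener_field_lt_top hB he hG
  have hε' : ENNReal.ofReal ε ≠ 0 := by simpa using hε
  -- Two errors of size `κ` add up to at most `ε δ`, as Markov's inequality requires; the minimum
  -- keeps `κ` finite when `δ = ∞`.
  set κ := ENNReal.ofReal ε * min δ 1 / 2 with hκ
  have hκ0 : 0 < κ := ENNReal.half_pos (mul_ne_zero hε' (lt_min hδ one_pos).ne')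
  have hκt : κ ≠ ∞ := ENNReal.div_ne_top
    (ENNReal.mul_ne_top ENNReal.ofReal_ne_top (ne_top_of_le_ne_top ENNReal.one_ne_top
      (min_le_right _ _))) two_ne_zero
  have hq0 : κ / (M + 1) ≠ 0 := (ENNReal.div_pos hκ0.ne' (by simp [hM.ne])).ne'
  have hqt : κ / (M + 1) ≠ ∞ := ENNReal.div_ne_top hκt (by simp)
  -- Chosen so that `η M ≤ κ`, with `M + 1` avoiding division by zero. The partition then has to
  -- beat the constant `c = 1 + 1/η`.
  set η := (κ / (M + 1)).toReal
  have hη : 0 < η := ENNReal.toReal_pos hq0 hqt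
  have hη' : ENNReal.ofReal η * M ≤ κ := by
    rw [ENNReal.ofReal_toReal hqt]
    calc κ / (M + 1) * M ≤ κ / (M + 1) * (M + 1) := by gcongr; exact le_self_add
      _ = κ := ENNReal.div_mul_cancel (by simp) (by simp [hM.ne])
  set c := ENNReal.ofReal (1 + 1 / η)
  have hr : 0 < κ / c := ENNReal.div_pos hκ0.ne' ENNReal.ofReal_ne_top
  obtain ⟨k₀, π₀, hπ₀, hfine⟩ := he.exists_partition hr
  refine ⟨k₀, π₀, hπ₀, fun k π hπ hπr => ?_⟩
  set w : Fin k → Ω → ℝ := fun a => wienerIntegral P μ B ((π ⁻¹' {a}).indicator 1)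
  set h : T → Ω → ℂ := fun t ω => cellField μ e π (fun a => w a ω) t
  have hD : ∀ ω, doubleSum P μ B K π ω = ∫ t, ‖h t ω‖ ^ 2 ∂τ := fun ω =>
    (integral_norm_sq_cellField he hK π fun a => w a ω).2.symm
  have hhm : AEStronglyMeasurable (Function.uncurry h) (τ.prod P) := by
    have hsum : Function.uncurry h = fun p : T × Ω =>
        ∑ a, cellMean μ π (fun y => e y p.1) a * (w a p.2 : ℂ) := rfl
    rw [hsum]
    refine Finset.aestronglyMeasurable_fun_sum _ fun a _ => AEStronglyMeasurable.fun_mul ?_ ?_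
    · exact ((measurable_cellMean he.measurable π a).comp measurable_fst).aestronglyMeasurable
    · have h1 := isWienerIntegral_wienerIntegral hB (hπ (measurableSet_singleton a))
      exact (h1.ofReal (𝕜 := ℂ)).2.1.1.comp_snd
  have hdist : ∫⁻ t, ∫⁻ ω, ‖G t ω - h t ω‖ₑ ^ 2 ∂P ∂τ ≤ κ / c :=
    (lintegral_mono fun t =>
      ((hG t).sub hB (isWienerIntegral_cellField hB hπ t)).lintegral_sq_le hB).trans
      (hfine k π hπ hπr)
  have hbound : ∫⁻ ω, ‖doubleSum P μ B K π ω - ∫ t, ‖G t ω‖ ^ 2 ∂τ‖ₑ ∂P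
      ≤ ENNReal.ofReal ε * δ := by
    simp_rw [hD]
    calc _ ≤ c * ∫⁻ t, ∫⁻ ω, ‖G t ω - h t ω‖ₑ ^ 2 ∂P ∂τ + ENNReal.ofReal η * M :=
          lintegral_enorm_integral_sq_sub_le hGm.aestronglyMeasurable hhm
            (ae_integrable_wiener_field hB he hGm hG)
            (ae_of_all _ fun ω => (integral_norm_sq_cellField he hK π fun a => w a ω).1) hη
      _ ≤ c * (κ / c) + κ := by gcongr
      _ ≤ κ + κ := by gcongr; exact ENNReal.mul_div_le
      _ = ENNReal.ofReal ε * min δ 1 := ENNReal.add_halves _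
      _ ≤ ENNReal.ofReal ε * δ := by gcongr; exact min_le_left _ _
  have hDm : AEStronglyMeasurable (fun ω => doubleSum P μ B K π ω) P := by
    simp_rw [hD]
    exact (hhm.norm.pow 2).prod_swap.integral_prod_right'
  calc P {ω | ε ≤ |doubleSum P μ B K π ω - ∫ t, ‖G t ω‖ ^ 2 ∂τ|}
      ≤ P {ω | ENNReal.ofReal ε ≤ ‖doubleSum P μ B K π ω - ∫ t, ‖G t ω‖ ^ 2 ∂τ‖ₑ} := by
        refine measure_mono fun ω hω => ?_
        rw [Set.mem_ofPred_eq, ← ofReal_norm]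
        exact ENNReal.ofReal_le_ofReal hω
    _ ≤ (∫⁻ ω, ‖doubleSum P μ B K π ω - ∫ t, ‖G t ω‖ ^ 2 ∂τ‖ₑ ∂P) / ENNReal.ofReal ε :=
        meas_ge_le_lintegral_div (hDm.sub hQ).enorm hε' ENNReal.ofReal_ne_top
    _ ≤ ENNReal.ofReal ε * δ / ENNReal.ofReal ε := by gcongr
    _ ≤ δ := by
        rw [mul_comm]
        exact ENNReal.div_le_of_le_mul le_rfl

end Limit

/-! ### Products of centered characters -/

section Product

variable {n : ℕ} {d : Fin n → ℕ} {ν ρ : (i : Fin n) → Measure (EuclideanSpace ℝ (Fin (d i)))}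
  [∀ i, IsProbabilityMeasure (ν i)] [∀ i, SigmaFinite (ρ i)]

/-- The product over `i ∈ S` of the centered characters is a square integrable field. -/
theorem isSquareField_prod_centeredChar
    (hρ : ∀ i, ∫⁻ t, ENNReal.ofReal (min 1 (‖t‖ ^ 2)) ∂(ρ i) < ∞)
    (hψ : ∀ i, Integrable (psiFun (ρ i)) (ν i)) (S : Finset (Fin n)) :
    IsSquareField (Measure.pi ν) (Measure.pi fun i : S => ρ i)
      (fun (x : MPoint d) (t : (i : S) → EuclideanSpace ℝ (Fin (d i))) =>
        ∏ i : S, centeredChar (ν i) (x i) (t i)) := by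
  have hm : Measurable fun p : MPoint d × ((i : S) → EuclideanSpace ℝ (Fin (d i))) =>
      ∏ i : S, centeredChar (ν i) (p.1 i) (p.2 i) := by
    refine Finset.measurable_fun_prod _ fun i _ => ?_
    have h1 : Measurable fun p : MPoint d × ((i : S) → EuclideanSpace ℝ (Fin (d i))) => p.1 i :=
      (measurable_pi_apply (i : Fin n)).comp measurable_fst
    have h2 : Measurable fun p : MPoint d × ((i : S) → EuclideanSpace ℝ (Fin (d i))) => p.2 i :=
      (measurable_pi_apply i).comp measurable_snd
    have h3 := (measurable_centeredChar (ν := ν i)).comp (h1.prodMk h2)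
    exact h3
  have hleft : ∀ x : MPoint d, MemLp (fun t : (i : S) → EuclideanSpace ℝ (Fin (d i)) =>
      ∏ i : S, centeredChar (ν i) (x i) (t i)) 2 (Measure.pi fun i : S => ρ i) := fun x => by
    have hmx : Measurable fun t : (i : S) → EuclideanSpace ℝ (Fin (d i)) =>
        ∏ i : S, centeredChar (ν i) (x i) (t i) := by
      have := hm.comp (measurable_prodMk_left (x := x))
      exact this
    rw [memLp_two_iff_integrable_sq_norm hmx.aestronglyMeasurable]
    simp_rw [norm_prod, ← Finset.prod_pow]
    exact Integrable.fintype_prod_dep (f := fun (i : S) t => ‖centeredChar (ν i) (x i) t‖ ^ 2)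
      fun i => (memLp_two_iff_integrable_sq_norm
        (memLp_centeredChar (hρ i) (hψ i) (x i)).1).1 (memLp_centeredChar (hρ i) (hψ i) (x i))
  refine ⟨hm, hleft, fun t => ?_, ?_⟩
  · have hmt := hm.comp (measurable_prodMk_right (y := t))
    refine MemLp.of_bound hmt.aestronglyMeasurable
      (∏ _i : S, 2) (ae_of_all _ fun x => ?_)
    rw [norm_prod]
    exact Finset.prod_le_prod (fun _ _ => norm_nonneg _) fun _ _ => norm_centeredChar_le _ _
  · set k : (i : Fin n) → EuclideanSpace ℝ (Fin (d i)) → ℝ≥0∞ :=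
      fun i x => ∫⁻ t, ‖centeredChar (ν i) x t‖ₑ ^ 2 ∂(ρ i)
    have hk : ∀ i, Measurable (k i) := fun i =>
      Measurable.lintegral_prod_right' (f := fun p : EuclideanSpace ℝ (Fin (d i)) ×
        EuclideanSpace ℝ (Fin (d i)) => ‖centeredChar (ν i) p.1 p.2‖ₑ ^ 2)
        (measurable_centeredChar.enorm.pow_const 2)
    have h1 : ∀ x : MPoint d, ∫⁻ t : (i : S) → EuclideanSpace ℝ (Fin (d i)),
        ‖∏ i : S, centeredChar (ν i) (x i) (t i)‖ₑ ^ 2 ∂(Measure.pi fun i : S => ρ i)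
        = ∏ i ∈ S, k i (x i) := fun x => by
      rw [lintegral_enorm_sq_eq (hleft x)]
      simp_rw [norm_prod, ← Finset.prod_pow]
      rw [integral_fintype_prod_eq_prod
        (fun (i : S) t => ‖centeredChar (ν i) (x i) t‖ ^ 2),
        ENNReal.ofReal_prod_of_nonneg fun i _ => integral_nonneg fun t => by positivity,
        ← Finset.prod_coe_sort S fun i => k i (x i)]
      exact Finset.prod_congr rfl fun i _ =>
        (lintegral_enorm_sq_eq (memLp_centeredChar (hρ i) (hψ i) (x i))).symm
    simp_rw [h1]
    -- Coordinates are independent under the product measure, so the second moment factors over `S`.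
    have hind : iIndepFun (fun i (x : MPoint d) => k i (x i)) (Measure.pi ν) :=
      iIndepFun_pi fun i => (hk i).aemeasurable
    rw [lintegral_prod_eq_prod_lintegral_of_indepFun S (fun i (x : MPoint d) => k i (x i)) hind
      fun i => (hk i).comp (measurable_pi_apply i)]
    refine ENNReal.prod_lt_top fun i _ => ?_
    rw [(measurePreserving_eval ν i).lintegral_comp (hk i)]
    exact lintegral_centeredChar_lt_top (hρ i) (hψ i)

theorem ofReal_prod_centeredPsi (hsymm : ∀ i, (ρ i).map (fun t => -t) = ρ i)
    (hρ : ∀ i, ∫⁻ t, ENNReal.ofReal (min 1 (‖t‖ ^ 2)) ∂(ρ i) < ∞)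
    (hψ : ∀ i, Integrable (psiFun (ρ i)) (ν i)) (S : Finset (Fin n)) (x y : MPoint d) :
    ((∏ i ∈ S, centeredPsi (ρ i) (ν i) (x i) (y i) : ℝ) : ℂ)
      = ∫ t : (i : S) → EuclideanSpace ℝ (Fin (d i)),
        (∏ i : S, centeredChar (ν i) (x i) (t i)) *
          starRingEnd ℂ (∏ i : S, centeredChar (ν i) (y i) (t i))
        ∂(Measure.pi fun i : S => ρ i) := by
  simp_rw [map_prod, ← Finset.prod_mul_distrib]
  rw [integral_fintype_prod_eq_prod (fun (i : S) t =>
    centeredChar (ν i) (x i) t * starRingEnd ℂ (centeredChar (ν i) (y i) t)),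
    Complex.ofReal_prod, ← Finset.prod_coe_sort]
  exact Finset.prod_congr rfl fun i _ => ofReal_centeredPsi (hsymm i) (hρ i) (hψ i) _ _

end Product

end

theorem proposition3p10
    {n : ℕ} {d : Fin n → ℕ}
    -- the random variables `X_i`
    {Ω' : Type*} [MeasurableSpace Ω'] (P' : Measure Ω') [IsProbabilityMeasure P']
    (X : (i : Fin n) → Ω' → EuclideanSpace ℝ (Fin (d i)))
    (hX : ∀ i, Measurable (X i)) (hindep : iIndepFun X P')
    -- the measures `ρ_i`
    (ρ : (i : Fin n) → Measure (EuclideanSpace ℝ (Fin (d i)))) [∀ i, SigmaFinite (ρ i)]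
    (hsymm : ∀ i, (ρ i).map (fun t => -t) = ρ i)
    (hρ : ∀ i, ∫⁻ t, ENNReal.ofReal (min 1 (‖t‖ ^ 2)) ∂(ρ i) < ∞)
    (hψ : ∀ i, Integrable (fun ω => psiFun (ρ i) (X i ω)) P')
    -- the field `B = W(F_X(·))`
    {Ω : Type*} [MeasurableSpace Ω] (P : Measure Ω) [IsProbabilityMeasure P]
    (B : MPoint d → Ω → ℝ)
    (hB : IsClockedBrownianSheet P (fun i => P'.map (X i)) B)
    -- the field `G_S`
    (S : Finset (Fin n)) (hS : 2 ≤ S.card)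
    (G : ((i : S) → EuclideanSpace ℝ (Fin (d i))) → Ω → ℂ)
    (hG : IsLimitField P (fun i => P'.map (X i)) (P'.map (fun ω i => X i ω)) B S G) :
    (∀ᵐ ω ∂P, Integrable (fun t => ‖G t ω‖ ^ 2) (Measure.pi fun i : S => ρ i)) ∧
    ∃ Q : Ω → ℝ,
      IsDoubleIntegral P (P'.map (fun ω i => X i ω)) B
        (fun x y => ∏ i ∈ S, centeredPsi (ρ i) (P'.map (X i)) (x i) (y i)) Q ∧
      ∀ᵐ ω ∂P, ∫ t, ‖G t ω‖ ^ 2 ∂(Measure.pi fun i : S => ρ i) = Q ω := by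
  have hprob : ∀ i, IsProbabilityMeasure (P'.map (X i)) := fun i =>
    Measure.isProbabilityMeasure_map (hX i).aemeasurable
  have hμ : P'.map (fun ω i => X i ω) = Measure.pi fun i => P'.map (X i) :=
    (iIndepFun_iff_map_fun_eq_pi_map fun i => (hX i).aemeasurable).1 hindep
  rw [hμ] at hG ⊢
  have hψ' : ∀ i, Integrable (psiFun (ρ i)) (P'.map (X i)) := fun i =>
    (integrable_map_measure measurable_psiFun.aestronglyMeasurable (hX i).aemeasurable).2 (hψ i)
  have he := isSquareField_prod_centeredChar hρ hψ' S
  -- The squared norm itself serves as `Q`.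
  exact ⟨ae_integrable_wiener_field hB.isOrthantNoise he hG.measurable hG.integral,
    _, isDoubleIntegral_norm_sq hB.isOrthantNoise he (ofReal_prod_centeredPsi hsymm hρ hψ' S)
      hG.measurable hG.integral, ae_of_all _ fun _ => rfl⟩
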